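/- \textbf{Setting.} Let $D$ be a measurable space with a $\sigma$-finite measure $\mu$, let $a<b$, $\Theta=[a,b]$, $\Lambda=b-a$, and let $f(\cdot;\theta)$, $\theta\in\Theta$, be measurable probability densities on $D$ with respect to $\mu$. Assume the following regularity conditions. 1. Distinct parameters give distinct distributions, and the support $\{x: f(x;\theta)>0\}$ does not depend on $\theta\in\Theta$. 2. For every $x\in D$, $f(x;\cdot)$ is continuous on $[a,b]$, and $\ell(x,\theta)=\ln f(x;\theta)$ is four times continuously differentiable in $\theta\in(a,b)$ (with $\ell(x,\cdot)=0$ for $x$ outside the support). Write $\ell^{(j)}$ for the $j$-th derivative in $\theta$. 3. There is a measurable $M:D\to[0,\infty)$ with $|\ell^{(j)}(x,\theta)|\le M(x)$ for $1\le j\le 4$, $x\in D$, $\theta\in(a,b)$, and every $\theta_0\in(a,b)$ has a neighbourhood $U\subseteq(a,b)$ and a function $g$ with $f(x;\theta)\le g(x)$ for all $x\in D,\theta\in U$ and $\int g\,(1+M^4)\,d\mu<\infty$. 4. $I_f(\theta)=E_\theta[(\ell'(X_1,\theta))^2]>0$ for $\theta\in(a,b)$. A randomized estimator $T$ on $n$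 points is a Markov kernel from $D^n$ to $\mathbb R$; $T(x)$ denotes its random output on $x$. It is $\epsilon$-differentially private if $\Pr(T(x)\in S)\le e^{\epsilon}\Pr(T(x')\in S)$ for all measurable $S\subseteq\mathbb R$ and all $x,x'\in D^n$ that agree in all but one position. Let $J_T(\theta)=E_\theta[(T(X)-\theta)^2]$, where $X=(X_1,\dots,X_n)$ is i.i.d. from $f(\cdot;\theta)$ and the expectation is also over the internal randomness. A sequence $T=(T_n)$ is asymptotically efficient if, for every $\theta\in(a,b)$, $J_{T_n}(\theta)\le \frac{1+o(1)}{nI_f(\theta)}$ as $n\to\infty$. An MLE is a family of measurable maps $\hat\theta_n:D^n\to[a,b]$, $n\ge0$, such that $\hat\theta_n(x)$ maximizes $\theta\mapsto\prod_{i} f(x_i;\theta)$ over $[a,b]$ for every $x$. Put $$b_1(\theta)=\frac{2E_\theta[\ell'(X_1,\theta)\ell''(X_1,\theta)]+E_\theta[\ell'''(X_1,\theta)]}{2I_f(\theta)^2}$$ for $\theta\in(a,b)$, and $b_1(a)=b_1(b)=0$. The bias-corrected MLE $\hat\theta_{bc}$ on $n\ge 1$ points is $\hat\theta_n-b_1(\hat\theta_n)/n$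 truncated to $[a,b]$ (and $\hat\theta_0$ for $n=0$). For $k\ge1$ and $\epsilon>0$, the sample-and-aggregate estimator is $$T^*_{n,k,\epsilon}(x)=\frac1k\sum_{j=1}^k\hat\theta_{bc}\big(x_{(j-1)t+1},\dots,x_{jt}\big)+R,\qquad t=\lfloor n/k\rfloor,$$ where $R$ is independent of the data with the Laplace density $\frac{1}{2s}e^{-|y|/s}$, $s=\Lambda/(k\epsilon)$; the remaining $n-kt$ points are not used. Let $k(n,\epsilon)=\lceil n^{3/5}\Lambda^{2/5}/\epsilon^{2/5}\rceil$. \textbf{Theorem.} Under these conditions there are $\epsilon_n>0$ with $\epsilon_n\to0$ and randomized estimators $T_n$ on $n$ points such that each $T_n$ is $\epsilon_n$-differentially private and $(T_n)$ is asymptotically efficient. More precisely, an MLE exists, and for every MLE: (i) for every $\theta\in(a,b)$, $E_\theta[\hat\theta_n-\theta]=\frac{b_1(\theta)}n+O(n^{-3/2})$; (ii) $T^*_{n,k,\epsilon}$ is an $\epsilon$-differentially private randomized estimator for all $n\ge0$, $k\ge1$, $\epsilon>0$; (iii) for every $\theta\in(a,b)$ and $\epsilon_0>0$ there is a constant $C$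 such that, for all $n\ge1$ and $0<\epsilon\le\epsilon_0$, $$J_{T^*_{n,k(n,\epsilon),\epsilon}}(\theta)\le\frac{1}{nI_f(\theta)}\left(1+C\,n^{-1/5}\epsilon^{-6/5}\right);$$ (iv) for every sequence $\epsilon_n>0$ with $\epsilon_n n^{1/6}\to\infty$, the estimators $T^*_{n,k(n,\epsilon_n),\epsilon_n}$ are asymptotically efficient. -/

import Mathlib

open MeasureTheory Filter Topology Set

noncomputable section

namespace PrivEst

variable {D : Type*} [MeasurableSpace D]

/-- The distribution on `D` with density `f(·; θ)` with respect to `μ`. -/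
def law (μ : Measure D) (f : D → ℝ → ℝ) (θ : ℝ) : Measure D :=
  μ.withDensity (fun x => ENNReal.ofReal (f x θ))

/-- The distribution of `n` i.i.d. draws from `f(·; θ)`. -/
def sampleLaw (μ : Measure D) (f : D → ℝ → ℝ) (n : ℕ) (θ : ℝ) : Measure (Fin n → D) :=
  Measure.pi (fun _ => law μ f θ)

/-- The `j`-th derivative in `θ` of the log-density `ln f(x; θ)`. -/
def logDeriv (f : D → ℝ → ℝ) (j : ℕ) (x : D) (θ : ℝ) : ℝ :=
  iteratedDeriv j (fun s => Real.log (f x s)) θ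

/-- The Fisher information `I_f(θ)`. -/
def fisherInfo (μ : Measure D) (f : D → ℝ → ℝ) (θ : ℝ) : ℝ :=
  ∫ x, (logDeriv f 1 x θ) ^ 2 ∂(law μ f θ)

/-- The coefficient `b₁(θ)` of `1/n` in the bias of the MLE (Cox-Snell formula). -/
def biasCoeff (μ : Measure D) (f : D → ℝ → ℝ) (θ : ℝ) : ℝ :=
  (2 * (∫ x, logDeriv f 1 x θ * logDeriv f 2 x θ ∂(law μ f θ))
      + ∫ x, logDeriv f 3 x θ ∂(law μ f θ)) / (2 * (fisherInfo μ f θ) ^ 2)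

/-- Regularity conditions of Cramér type on a one-parameter model with densities `f(·; θ)` and
bounded parameter space `[a, b]`. -/
structure RegularModel (μ : Measure D) (f : D → ℝ → ℝ) (a b : ℝ) : Prop where
  lt : a < b
  meas : ∀ θ ∈ Icc a b, Measurable (fun x => f x θ)
  nonneg : ∀ x, ∀ θ ∈ Icc a b, 0 ≤ f x θ
  prob : ∀ θ ∈ Icc a b, IsProbabilityMeasure (law μ f θ)
  identifiable : ∀ θ ∈ Icc a b, ∀ θ' ∈ Icc a b, law μ f θ = law μ f θ' → θ = θ'
  common_support : ∀ x, ∀ θ ∈ Icc a b, ∀ θ' ∈ Icc a b, f x θ = 0 → f x θ' = 0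
  cont : ∀ x, ContinuousOn (f x) (Icc a b)
  smooth : ∀ x, ContDiffOn ℝ 4 (fun θ => Real.log (f x θ)) (Ioo a b)
  fisher_pos : ∀ θ ∈ Ioo a b, 0 < fisherInfo μ f θ
  /-- An envelope `M` for four derivatives of the log-density, with fourth moments that are
  locally uniform in the parameter. -/
  envelope : ∃ M : D → ℝ, Measurable M ∧
    (∀ x, ∀ θ ∈ Ioo a b, ∀ j : ℕ, 1 ≤ j → j ≤ 4 → |logDeriv f j x θ| ≤ M x) ∧
    ∀ θ₀ ∈ Ioo a b, ∃ δ > 0, ∃ g : D → ℝ,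
      Integrable (fun x => g x * (1 + M x ^ 4)) μ ∧
      ∀ x, ∀ θ ∈ Ioo a b, |θ - θ₀| < δ → f x θ ≤ g x

/-- `mle` is a (measurable) maximum likelihood estimator over `[a, b]`, for every sample size. -/
def IsMLE (f : D → ℝ → ℝ) (a b : ℝ) (mle : ∀ n : ℕ, (Fin n → D) → ℝ) : Prop :=
  ∀ n, Measurable (mle n) ∧ ∀ x : Fin n → D, mle n x ∈ Icc a b ∧
    ∀ θ ∈ Icc a b, ∏ i, f (x i) θ ≤ ∏ i, f (x i) (mle n x)

/-- The bias-corrected MLE `θ̂ - b₁(θ̂)/n`, truncated to the parameter space `[a, b]`.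
The correction `b₁` is taken to be `0` at the two endpoints, where it is not defined. -/
def bcMLE (μ : Measure D) (f : D → ℝ → ℝ) (a b : ℝ) (mle : ∀ n : ℕ, (Fin n → D) → ℝ)
    (n : ℕ) (x : Fin n → D) : ℝ :=
  max a (min b (mle n x - (Ioo a b).indicator (biasCoeff μ f) (mle n x) / n))

/-- The Laplace (double-exponential) distribution with density `e^{-|y|/s} / (2 s)`. -/
def laplace (s : ℝ) : Measure ℝ :=
  volume.withDensity (fun y => ENNReal.ofReal (1 / (2 * s) * Real.exp (-(|y| / s))))

theorem blockIndex_lt {n k : ℕ} (j : Fin k) (i : Fin (n / k)) :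
    (j : ℕ) * (n / k) + i < n := by
  have h1 : (j : ℕ) * (n / k) + i < ((j : ℕ) + 1) * (n / k) := by
    have := i.isLt
    linarith
  have h2 : ((j : ℕ) + 1) * (n / k) ≤ k * (n / k) := Nat.mul_le_mul_right _ j.isLt
  exact lt_of_lt_of_le h1 (h2.trans (Nat.mul_div_le n k))

/-- The `j`-th of `k` consecutive disjoint blocks of `⌊n / k⌋` data points; the fewer than `k`
points that remain are not used. -/
def block {D : Type*} {n k : ℕ} (x : Fin n → D) (j : Fin k) : Fin (n / k) → D :=
  fun i => x ⟨(j : ℕ) * (n / k) + i, blockIndex_lt j i⟩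

/-- The distribution of the sample-and-aggregate estimator on input `x`: the average of the
bias-corrected MLEs of the `k` blocks plus Laplace noise of scale `Λ / (k ε)`, `Λ = b - a`. -/
def sampleAggregate (μ : Measure D) (f : D → ℝ → ℝ) (a b : ℝ)
    (mle : ∀ n : ℕ, (Fin n → D) → ℝ) (ε : ℝ) (k n : ℕ) (x : Fin n → D) : Measure ℝ :=
  (laplace ((b - a) / (k * ε))).map
    (fun r => (1 / (k : ℝ)) * (∑ j : Fin k, bcMLE μ f a b mle (n / k) (block x j)) + r)

/-- The number of blocks `k = ⌈n^{3/5} Λ^{2/5} / ε^{2/5}⌉`. -/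
def numBlocks (Λ ε : ℝ) (n : ℕ) : ℕ :=
  ⌈(n : ℝ) ^ (3 / 5 : ℝ) * Λ ^ (2 / 5 : ℝ) / ε ^ (2 / 5 : ℝ)⌉₊

/-- A randomized estimator on `n` data points: the output distribution is a probability measure
that depends measurably on the data, i.e. a Markov kernel. -/
def IsRandomizedEstimator {n : ℕ} (T : (Fin n → D) → Measure ℝ) : Prop :=
  Measurable T ∧ ∀ x, IsProbabilityMeasure (T x)

/-- Two data sets are neighbors if they agree in all but one position. -/
def Neighbors {D : Type*} {n : ℕ} (x x' : Fin n → D) : Prop :=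
  ∃ i, ∀ j, j ≠ i → x j = x' j

/-- `ε`-differential privacy of a randomized algorithm with output distributions `T x`. -/
def IsDifferentiallyPrivate {D : Type*} {n : ℕ} (ε : ℝ) (T : (Fin n → D) → Measure ℝ) : Prop :=
  ∀ x x' : Fin n → D, Neighbors x x' → ∀ S : Set ℝ, MeasurableSet S →
    T x S ≤ ENNReal.ofReal (Real.exp ε) * T x' S

/-- The mean squared error `J_T(θ)`, over both the i.i.d. sample and the internal randomness. -/
def mse (μ : Measure D) (f : D → ℝ → ℝ) {n : ℕ} (T : (Fin n → D) → Measure ℝ) (θ : ℝ) :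
    ENNReal :=
  ∫⁻ x, ∫⁻ y, ENNReal.ofReal ((y - θ) ^ 2) ∂(T x) ∂(sampleLaw μ f n θ)

/-- Asymptotic efficiency: `J_{T_n}(θ) ≤ (1 + o(1)) / (n I_f(θ))` at every interior parameter. -/
def AsymptoticallyEfficient (μ : Measure D) (f : D → ℝ → ℝ) (a b : ℝ)
    (T : ∀ n : ℕ, (Fin n → D) → Measure ℝ) : Prop :=
  ∀ θ ∈ Ioo a b, ∃ δ : ℕ → ℝ, Tendsto δ atTop (𝓝 0) ∧
    ∀ᶠ n : ℕ in atTop,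
      mse μ f (T n) θ ≤ ENNReal.ofReal ((1 + δ n) / (n * fisherInfo μ f θ))

end PrivEst

end

/-!
Everything rests on a third-order stochastic expansion of the maximum likelihood estimator `θ̂`.
Write `A`, `B`, `C` for the empirical means of the score, of the centered second and of the
centered third derivative of the log-density at the true parameter `θ₀`, and
`u = |A| + |B| + |C| + n^{-1/2}`. The envelope `M` has four moments, so `u` has fourth moment
`O(n⁻²)` (`integral_sum_pow_four_le`). By the same moment bound, Gibbs' inequality and compactness
of the parameter space, `θ̂` leaves a fixed neighborhood of `θ₀` with probability `O(n⁻²)`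
(`IsMLE.exists_measureReal_abs_sub_ge_le`). Inside that neighborhood `θ̂` solves the likelihood
equation, which is expanded to second order with a remainder controlled by the mean of `M`, and
solving it gives (`exists_root_expansion`)
`θ̂ - θ₀ = A / I + A B / I² + J A² / (2 I³) + O(u³)`, with `I` the Fisher information and `J` the
mean third derivative. A remainder that is `O(u³)` off an event of probability `O(n⁻²)`, and
`O(1 + u⁴)` on it, has mean `O(n^{-3/2})` (`exists_integral_remainder_le`). Taking expectations,
`E A = 0` and the covariances of `A` and `B` produce exactly `b₁(θ₀) / n`. Since `b₁` is
differentiable at `θ₀` (`differentiableAt_biasCoeff`), subtracting `b₁(θ̂) / n` leaves a bias of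
order `n^{-3/2}` and a mean squared error `1 / (n I) + O(n^{-3/2})`
(`IsMLE.exists_moment_expansions`).

Privacy is that of the Laplace mechanism (`laplace_map_add_le`): one data point affects one block,
hence moves the average by at most `Λ / k`. The blocks are independent, so averaging divides the
variance by `k` while the squared bias `O(t⁻³)` of a block of length `t` remains; adding the noise
variance `2 Λ² / (k ε)²` bounds the mean squared error (`mse_sampleAggregate_le`). With the
prescribed `k` all relative errors are at most of order `√(k / n)`, `k³ / n²` and
`n^{-1/5} ε^{-6/5}` (`exists_mse_numBlocks_le`), from which the explicit rate and the asymptotic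
efficiency follow.
-/

noncomputable section

namespace PrivEst

/-! ### Moments of empirical means -/

section Moments

open ProbabilityTheory

variable {Ω : Type*} [MeasurableSpace Ω] {P : Measure Ω}

theorem integrable_pow_of_memLp_four [IsFiniteMeasure P] {Y : Ω → ℝ} (hY : MemLp Y 4 P) {j : ℕ}
    (hj : j ≤ 4) : Integrable (fun x => Y x ^ j) P := by
  have h1 : MemLp Y (j : ENNReal) P := hY.mono_exponent (by exact_mod_cast hj)
  refine (h1.integrable_norm_pow').mono' (h1.1.pow j) (ae_of_all _ fun x => ?_)
  simp

/-- The fourth moment of a sum of independent centered variables grows at most quadratically in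
the number of summands. -/
theorem integral_sum_pow_four_le [IsProbabilityMeasure P] {ι : Type*} {X : ι → Ω → ℝ}
    (hind : iIndepFun X P) (hm : ∀ i, Measurable (X i)) (hX : ∀ i, MemLp (X i) 4 P)
    (h0 : ∀ i, ∫ ω, X i ω ∂P = 0) {κ σ : ℝ} (h2 : ∀ i, ∫ ω, X i ω ^ 2 ∂P ≤ σ)
    (h4 : ∀ i, ∫ ω, X i ω ^ 4 ∂P ≤ κ) (hσκ : σ ^ 2 ≤ κ) (s : Finset ι) :
    (∫ ω, (∑ i ∈ s, X i ω) ^ 2 ∂P ≤ s.card * σ) ∧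
      ∫ ω, (∑ i ∈ s, X i ω) ^ 4 ∂P ≤ 3 * (s.card : ℝ) ^ 2 * κ := by
  classical
  induction s using Finset.induction_on with
  | empty => simp
  | insert i s his ih =>
    obtain ⟨ih2, ih4⟩ := ih
    set S : Ω → ℝ := fun ω => ∑ j ∈ s, X j ω with hS
    have hSm : Measurable S := Finset.measurable_fun_sum s fun j _ => hm j
    have hSL : MemLp S 4 P := memLp_finsetSum s fun j _ => hX j
    have hI : IndepFun (X i) S P := by
      have := (hind.indepFun_finsetSum_of_notMem hm his).symm
      convert this using 1
      ext ω; simp [hS]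
    have hIp : ∀ p q : ℕ, IndepFun (fun ω => X i ω ^ p) (fun ω => S ω ^ q) P := fun p q =>
      hI.comp (measurable_id.pow_const p) (measurable_id.pow_const q)
    have hint : ∀ p q : ℕ, p ≤ 4 → q ≤ 4 → Integrable (fun ω => X i ω ^ p * S ω ^ q) P :=
      fun p q hp hq => (hIp p q).integrable_mul (integrable_pow_of_memLp_four (hX i) hp)
        (integrable_pow_of_memLp_four hSL hq)
    have hval : ∀ p q : ℕ, ∫ ω, X i ω ^ p * S ω ^ q ∂P
        = (∫ ω, X i ω ^ p ∂P) * ∫ ω, S ω ^ q ∂P := fun p q =>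
      (hIp p q).integral_fun_mul_eq_mul_integral ((hm i).pow_const p).aestronglyMeasurable
        (hSm.pow_const q).aestronglyMeasurable
    have hS0 : ∫ ω, S ω ∂P = 0 := by
      rw [hS, integral_finsetSum s fun j _ => (hX j).integrable (by norm_num)]
      simp [h0]
    have hσ0 : 0 ≤ ∫ ω, X i ω ^ 2 ∂P := integral_nonneg fun ω => by positivity
    have hS20 : 0 ≤ ∫ ω, S ω ^ 2 ∂P := integral_nonneg fun ω => by positivity
    have e2 : ∫ ω, (∑ j ∈ insert i s, X j ω) ^ 2 ∂P
        = ∫ ω, X i ω ^ 2 ∂P + ∫ ω, S ω ^ 2 ∂P := by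
      have : ∀ ω, (∑ j ∈ insert i s, X j ω) ^ 2
          = X i ω ^ 2 * S ω ^ 0 + 2 * (X i ω ^ 1 * S ω ^ 1) + X i ω ^ 0 * S ω ^ 2 := fun ω => by
        rw [Finset.sum_insert his]; ring
      simp_rw [this]
      rw [integral_add _ (hint 0 2 (by norm_num) (by norm_num)),
        integral_add (hint 2 0 (by norm_num) (by norm_num)), integral_const_mul, hval, hval, hval]
      · simp [h0]
      · exact (hint 1 1 (by norm_num) (by norm_num)).const_mul 2
      · exact (hint 2 0 (by norm_num) (by norm_num)).add
          ((hint 1 1 (by norm_num) (by norm_num)).const_mul 2)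
    have e4 : ∫ ω, (∑ j ∈ insert i s, X j ω) ^ 4 ∂P
        = ∫ ω, X i ω ^ 4 ∂P + 6 * ((∫ ω, X i ω ^ 2 ∂P) * ∫ ω, S ω ^ 2 ∂P)
          + ∫ ω, S ω ^ 4 ∂P := by
      have : ∀ ω, (∑ j ∈ insert i s, X j ω) ^ 4
          = X i ω ^ 4 * S ω ^ 0 + 6 * (X i ω ^ 2 * S ω ^ 2) + X i ω ^ 0 * S ω ^ 4
            + 4 * (X i ω ^ 3 * S ω ^ 1) + 4 * (X i ω ^ 1 * S ω ^ 3) := fun ω => by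
        rw [Finset.sum_insert his]; ring
      simp_rw [this]
      have i1 := hint 4 0 (by norm_num) (by norm_num)
      have i2 := (hint 2 2 (by norm_num) (by norm_num)).const_mul 6
      have i3 := hint 0 4 (by norm_num) (by norm_num)
      have i4 := (hint 3 1 (by norm_num) (by norm_num)).const_mul 4
      have i5 := (hint 1 3 (by norm_num) (by norm_num)).const_mul 4
      rw [integral_add (((i1.fun_add i2).fun_add i3).fun_add i4) i5,
        integral_add ((i1.fun_add i2).fun_add i3) i4,
        integral_add (i1.fun_add i2) i3, integral_add i1 i2, integral_const_mul, integral_const_mul,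
        integral_const_mul, hval, hval, hval, hval, hval]
      simp [h0, hS0]
    rw [e2, e4, Finset.card_insert_of_notMem his]
    push_cast
    constructor
    · linarith [h2 i]
    · have hσ : 0 ≤ σ := hσ0.trans (h2 i)
      have : (∫ ω, X i ω ^ 2 ∂P) * ∫ ω, S ω ^ 2 ∂P ≤ σ * (s.card * σ) :=
        mul_le_mul (h2 i) ih2 hS20 hσ
      have hc : (0 : ℝ) ≤ s.card := by positivity
      have hk : 0 ≤ κ := (sq_nonneg σ).trans hσκ
      nlinarith [h4 i, mul_le_mul_of_nonneg_left hσκ hc]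

end Moments

/-- The empirical mean of `Y` over the sample `x`. -/
def empMean (n : ℕ) (Y : D → ℝ) (x : Fin n → D) : ℝ := (∑ i, Y (x i)) / n

section EmpMean

open ProbabilityTheory

variable {D : Type*} [MeasurableSpace D] {P : Measure D} [IsProbabilityMeasure P]
  {Y Y' : D → ℝ}

theorem measurable_empMean {n : ℕ} (hY : Measurable Y) : Measurable (empMean n Y) := by
  unfold empMean; fun_prop

theorem memLp_eval {n : ℕ} (hY : MemLp Y 4 P) (i : Fin n) :
    MemLp (fun x : Fin n → D => Y (x i)) 4 (Measure.pi fun _ => P) :=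
  hY.comp_measurePreserving (measurePreserving_eval (fun _ : Fin n => P) i)

theorem memLp_empMean {n : ℕ} (hY : MemLp Y 4 P) :
    MemLp (empMean n Y) 4 (Measure.pi fun _ => P) := by
  have := (memLp_finsetSum (Finset.univ : Finset (Fin n)) fun i _ => memLp_eval hY i).mul_const
    ((n : ℝ)⁻¹)
  refine this.ae_eq (ae_of_all _ fun x => ?_)
  simp [empMean, div_eq_mul_inv]

theorem integral_eval {n : ℕ} (Z : D → ℝ) (hZ : AEStronglyMeasurable Z P) (i : Fin n) :
    ∫ x : Fin n → D, Z (x i) ∂(Measure.pi fun _ => P) = ∫ y, Z y ∂P := by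
  have h := measurePreserving_eval (fun _ : Fin n => P) i
  conv_rhs => rw [← h.map_eq]
  rw [integral_map h.measurable.aemeasurable (by rw [h.map_eq]; exact hZ)]

theorem integral_empMean {n : ℕ} (hn : n ≠ 0) (hY : Integrable Y P) :
    ∫ x, empMean n Y x ∂(Measure.pi fun _ => P) = ∫ y, Y y ∂P := by
  have hi : ∀ i : Fin n, Integrable (fun x : Fin n → D => Y (x i)) (Measure.pi fun _ => P) :=
    fun i => (measurePreserving_eval (fun _ : Fin n => P) i).integrable_comp_of_integrable hY
  simp only [empMean]
  rw [integral_div, integral_finsetSum _ fun i _ => hi i]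
  simp_rw [integral_eval Y hY.1]
  simp
  field_simp

theorem empMean_integrable_mul {n : ℕ} (hY : MemLp Y 4 P) (hY' : MemLp Y' 4 P) :
    Integrable (fun x => empMean n Y x * empMean n Y' x) (Measure.pi fun _ => P) :=
  ((memLp_empMean hY).mono_exponent (p := 2) (by norm_num)).integrable_mul
    ((memLp_empMean hY').mono_exponent (p := 2) (by norm_num))

/-- Covariance of two empirical means of centered functions. -/
theorem integral_empMean_mul {n : ℕ} (hn : n ≠ 0) (mY : Measurable Y) (mY' : Measurable Y')
    (hY : MemLp Y 4 P) (hY' : MemLp Y' 4 P) (h0 : ∫ y, Y y ∂P = 0) :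
    ∫ x, empMean n Y x * empMean n Y' x ∂(Measure.pi fun _ => P)
      = (∫ y, Y y * Y' y ∂P) / n := by
  have hind : iIndepFun (fun (i : Fin n) (x : Fin n → D) => x i) (Measure.pi fun _ => P) :=
    iIndepFun_pi (X := fun _ => id) fun _ => aemeasurable_id
  have e : ∀ x : Fin n → D, empMean n Y x * empMean n Y' x
      = (∑ i, ∑ j, Y (x i) * Y' (x j)) / n ^ 2 := fun x => by
    simp only [empMean, ← Finset.sum_mul_sum]
    field_simp
  have hint : ∀ i j : Fin n, Integrable (fun x : Fin n → D => Y (x i) * Y' (x j))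
      (Measure.pi fun _ => P) := fun i j =>
    ((memLp_eval hY i).mono_exponent (p := 2) (by norm_num)).integrable_mul
      ((memLp_eval hY' j).mono_exponent (p := 2) (by norm_num))
  have hval : ∀ i j : Fin n, ∫ x : Fin n → D, Y (x i) * Y' (x j) ∂(Measure.pi fun _ => P)
      = if j = i then ∫ y, Y y * Y' y ∂P else 0 := by
    intro i j
    split_ifs with h
    · subst h
      exact integral_eval (fun y => Y y * Y' y) (mY.mul mY').aestronglyMeasurable j
    · have hI : IndepFun (fun x : Fin n → D => Y (x i)) (fun x => Y' (x j))
          (Measure.pi fun _ => P) := (hind.indepFun (Ne.symm h)).comp mY mY'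
      rw [hI.integral_fun_mul_eq_mul_integral (memLp_eval hY i).1 (memLp_eval hY' j).1,
        integral_eval Y mY.aestronglyMeasurable, h0, zero_mul]
  simp_rw [e]
  rw [integral_div, integral_finsetSum _ fun i _ => integrable_finsetSum _ fun j _ => hint i j]
  simp_rw [integral_finsetSum _ fun j _ => hint _ j, hval]
  simp
  field_simp

theorem integral_empMean_pow_four_le {n : ℕ} (hn : n ≠ 0) (mY : Measurable Y)
    (hY : MemLp Y 4 P) (h0 : ∫ y, Y y ∂P = 0) :
    ∫ x, empMean n Y x ^ 4 ∂(Measure.pi fun _ => P) ≤ 3 * (∫ y, Y y ^ 4 ∂P) / (n : ℝ) ^ 2 := by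
  have hind : iIndepFun (fun (i : Fin n) (x : Fin n → D) => Y (x i)) (Measure.pi fun _ => P) :=
    iIndepFun_pi (X := fun _ => Y) fun _ => mY.aemeasurable
  have i2 : Integrable (fun y => Y y ^ 2) P := integrable_pow_of_memLp_four hY (by norm_num)
  have i4 : Integrable (fun y => Y y ^ 4) P := integrable_pow_of_memLp_four hY (by norm_num)
  have hσκ : (∫ y, Y y ^ 2 ∂P) ^ 2 ≤ ∫ y, Y y ^ 4 ∂P := by
    set m := ∫ y, Y y ^ 2 ∂P with hm
    have : 0 ≤ ∫ y, (Y y ^ 2 - m) ^ 2 ∂P := integral_nonneg fun y => sq_nonneg _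
    have e : ∀ y, (Y y ^ 2 - m) ^ 2 = Y y ^ 4 - 2 * m * Y y ^ 2 + m ^ 2 := fun y => by ring
    simp_rw [e] at this
    rw [integral_add (Integrable.sub' i4 (i2.const_mul _)) (integrable_const _),
      integral_sub i4 (i2.const_mul _), integral_const_mul, ← hm] at this
    simp at this
    nlinarith
  have := (integral_sum_pow_four_le hind (fun i => mY.comp (measurable_pi_apply i))
    (fun i => memLp_eval hY i) (fun i => by rw [integral_eval Y mY.aestronglyMeasurable, h0])
    (fun i => (integral_eval (fun y => Y y ^ 2) i2.1 i).le)
    (fun i => (integral_eval (fun y => Y y ^ 4) i4.1 i).le) hσκ Finset.univ).2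
  simp only [Finset.card_univ, Fintype.card_fin] at this
  simp only [empMean, div_pow]
  rw [integral_div]
  have hn' : (0 : ℝ) < n := by positivity
  rw [div_le_div_iff₀ (by positivity) (by positivity)]
  nlinarith [pow_pos hn' 2]

/-- Large deviations of an empirical mean have probability `O(n⁻²)`. -/
theorem exists_measureReal_abs_empMean_sub_ge_le (mY : Measurable Y) (hY : MemLp Y 4 P)
    {c : ℝ} (hc : 0 < c) : ∃ C : ℝ, ∀ n : ℕ, 1 ≤ n →
      (Measure.pi fun _ : Fin n => P).real {x | c ≤ |empMean n Y x - ∫ y, Y y ∂P|}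
        ≤ C / (n : ℝ) ^ 2 := by
  set Z : D → ℝ := fun y => Y y - ∫ y, Y y ∂P with hZ
  have mZ : Measurable Z := mY.sub_const _
  have hZL : MemLp Z 4 P := hY.sub (memLp_const _)
  have hi := hY.integrable (q := 4) (by norm_num)
  have hZ0 : ∫ y, Z y ∂P = 0 := by
    rw [hZ, integral_sub hi (integrable_const _)]; simp
  refine ⟨3 * (∫ y, Z y ^ 4 ∂P) / c ^ 4, fun n hn => ?_⟩
  have hn0 : n ≠ 0 := by omega
  have hn' : (0 : ℝ) < n := by positivity
  have e : ∀ x : Fin n → D, empMean n Y x - ∫ y, Y y ∂P = empMean n Z x := fun x => by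
    simp only [empMean, hZ, Finset.sum_sub_distrib]
    simp
    field_simp
  have h1 := mul_meas_ge_le_integral_of_nonneg (μ := Measure.pi fun _ : Fin n => P)
    (f := fun x => empMean n Z x ^ 4) (ae_of_all _ fun x => by positivity)
    (integrable_pow_of_memLp_four (memLp_empMean hZL) le_rfl) (c ^ 4)
  have h2 := integral_empMean_pow_four_le hn0 mZ hZL hZ0
  have h3 : {x : Fin n → D | c ≤ |empMean n Y x - ∫ y, Y y ∂P|}
      = {x | c ^ 4 ≤ empMean n Z x ^ 4} := by
    ext x
    simp only [mem_ofPred_eq, e]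
    rw [← Even.pow_abs (by decide : Even 4) (empMean n Z x)]
    exact (pow_le_pow_iff_left₀ hc.le (abs_nonneg _) (by norm_num)).symm
  rw [h3, div_div, mul_comm (c ^ 4), ← div_div, le_div_iff₀ (by positivity), mul_comm]
  exact h1.trans h2

end EmpMean

/-! ### Differentiation in the parameter under the expectation -/

section Model

variable {D : Type*} [MeasurableSpace D] {μ : Measure D} {f : D → ℝ → ℝ} {a b : ℝ} {M : D → ℝ}

/-- `M` dominates the first four derivatives of the log-density and has fourth moments that are
locally uniform in the parameter. -/
structure IsEnvelope (μ : Measure D) (f : D → ℝ → ℝ) (a b : ℝ) (M : D → ℝ) : Prop where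
  meas : Measurable M
  nonneg : ∀ x, 0 ≤ M x
  abs_le : ∀ x, ∀ θ ∈ Ioo a b, ∀ j : ℕ, 1 ≤ j → j ≤ 4 → |logDeriv f j x θ| ≤ M x
  dom : ∀ θ₀ ∈ Ioo a b, ∃ δ > 0, ∃ g : D → ℝ, Integrable (fun x => g x * (1 + M x ^ 4)) μ ∧
    ∀ x, ∀ θ ∈ Ioo a b, |θ - θ₀| < δ → f x θ ≤ g x

theorem RegularModel.exists_isEnvelope (hreg : RegularModel μ f a b) :
    ∃ M, IsEnvelope μ f a b M := by
  obtain ⟨M, h1, h2, h3⟩ := hreg.envelope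
  obtain ⟨θ, hθ⟩ := exists_between hreg.lt
  exact ⟨M, h1, fun x => (abs_nonneg _).trans (h2 x θ hθ 1 le_rfl (by norm_num)), h2, h3⟩

theorem integral_law (hreg : RegularModel μ f a b) {θ : ℝ} (hθ : θ ∈ Icc a b) (p : D → ℝ) :
    ∫ x, p x ∂(law μ f θ) = ∫ x, f x θ * p x ∂μ := by
  rw [law, integral_withDensity_eq_integral_toReal_smul (hreg.meas θ hθ).ennreal_ofReal
    (ae_of_all _ fun _ => ENNReal.ofReal_lt_top)]
  simp [ENNReal.toReal_ofReal (hreg.nonneg _ θ hθ)]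

theorem integrable_law_iff (hreg : RegularModel μ f a b) {θ : ℝ} (hθ : θ ∈ Icc a b)
    {p : D → ℝ} : Integrable p (law μ f θ) ↔ Integrable (fun x => f x θ * p x) μ := by
  rw [law, integrable_withDensity_iff_integrable_smul' (hreg.meas θ hθ).ennreal_ofReal
    (ae_of_all _ fun _ => ENNReal.ofReal_lt_top)]
  simp [ENNReal.toReal_ofReal (hreg.nonneg _ θ hθ)]

theorem ae_law_pos (hreg : RegularModel μ f a b) {θ : ℝ} (hθ : θ ∈ Icc a b) :
    ∀ᵐ x ∂(law μ f θ), 0 < f x θ := by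
  rw [law, ae_withDensity_iff (hreg.meas θ hθ).ennreal_ofReal]
  refine ae_of_all _ fun x hx => ?_
  by_contra h
  exact hx (ENNReal.ofReal_eq_zero.2 (not_lt.1 h))

theorem RegularModel.pos_of_pos (hreg : RegularModel μ f a b) {x : D} {θ θ' : ℝ}
    (hθ : θ ∈ Icc a b) (hθ' : θ' ∈ Icc a b) (h : 0 < f x θ) : 0 < f x θ' :=
  lt_of_le_of_ne (hreg.nonneg x θ' hθ') fun h0 =>
    h.ne' (hreg.common_support x θ' hθ' θ hθ h0.symm)

theorem hasDerivAt_logDeriv (hreg : RegularModel μ f a b) {θ : ℝ} (hθ : θ ∈ Ioo a b) {j : ℕ}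
    (hj : j ≤ 3) (x : D) : HasDerivAt (logDeriv f j x) (logDeriv f (j + 1) x θ) θ := by
  have h1 := (hreg.smooth x).differentiableOn_iteratedDerivWithin (m := j)
    (by exact_mod_cast (by omega : j < 4)) isOpen_Ioo.uniqueDiffOn
  have h2 : DifferentiableOn ℝ (logDeriv f j x) (Ioo a b) :=
    h1.congr fun s hs => (iteratedDerivWithin_of_isOpen isOpen_Ioo hs).symm
  have h3 := (h2 θ hθ).differentiableAt (isOpen_Ioo.mem_nhds hθ)
  have h4 : logDeriv f (j + 1) x θ = deriv (logDeriv f j x) θ := by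
    rw [logDeriv, iteratedDeriv_succ]; rfl
  rw [h4]
  exact h3.hasDerivAt

theorem logDeriv_zero {D : Type*} {f : D → ℝ → ℝ} (x : D) (θ : ℝ) :
    logDeriv f 0 x θ = Real.log (f x θ) := by
  simp [logDeriv]

theorem measurable_logDeriv (hreg : RegularModel μ f a b) {j : ℕ} (hj : j ≤ 4) {θ : ℝ}
    (hθ : θ ∈ Ioo a b) : Measurable fun x => logDeriv f j x θ := by
  induction j generalizing θ with
  | zero =>
    simp_rw [logDeriv_zero]
    exact (hreg.meas θ (Ioo_subset_Icc_self hθ)).log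
  | succ j ih =>
    -- the derivative is the limit of difference quotients along a sequence that stays in `(a, b)`
    have hb : 0 < b - θ := sub_pos.2 hθ.2
    set h : ℕ → ℝ := fun m => (b - θ) / (m + 2) with hh
    have hpos : ∀ m, 0 < h m := fun m => by positivity
    have hmem : ∀ m, θ + h m ∈ Ioo a b := fun m => by
      refine ⟨by linarith [hpos m, hθ.1], ?_⟩
      have : h m < b - θ := div_lt_self hb (by linarith [Nat.cast_nonneg (α := ℝ) m])
      linarith
    have hlim : Tendsto h atTop (𝓝[≠] 0) := by
      refine tendsto_nhdsWithin_iff.2 ⟨?_, Eventually.of_forall fun m => (hpos m).ne'⟩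
      have : Tendsto (fun m : ℕ => (m : ℝ) + 2) atTop atTop :=
        tendsto_atTop_add_const_right _ _ tendsto_natCast_atTop_atTop
      exact this.const_div_atTop _
    refine measurable_of_tendsto_metrizable
      (f := fun m x => (h m)⁻¹ • (logDeriv f j x (θ + h m) - logDeriv f j x θ)) (fun m => ?_) ?_
    · simp only [smul_eq_mul]
      exact ((ih (by omega) (hmem m)).sub (ih (by omega) hθ)).const_mul _
    · refine tendsto_pi_nhds.2 fun x => ?_
      exact (hasDerivAt_iff_tendsto_slope_zero.1
        (hasDerivAt_logDeriv hreg hθ (by omega) x)).comp hlim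

theorem hasDerivAt_density (hreg : RegularModel μ f a b) {θ : ℝ} (hθ : θ ∈ Ioo a b) (x : D) :
    HasDerivAt (f x) (f x θ * logDeriv f 1 x θ) θ := by
  have hθ' := Ioo_subset_Icc_self hθ
  rcases (hreg.nonneg x θ hθ').eq_or_lt with h | h
  · rw [← h, zero_mul]
    refine (hasDerivAt_const θ (0 : ℝ)).congr_of_eventuallyEq ?_
    filter_upwards [isOpen_Ioo.mem_nhds hθ] with s hs
    exact hreg.common_support x θ hθ' s (Ioo_subset_Icc_self hs) h.symm
  · have h1 := (hasDerivAt_logDeriv hreg hθ (j := 0) (by norm_num) x).exp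
    have h2 : HasDerivAt (f x) (Real.exp (logDeriv f 0 x θ) * logDeriv f (0 + 1) x θ) θ := by
      refine h1.congr_of_eventuallyEq ?_
      filter_upwards [isOpen_Ioo.mem_nhds hθ] with s hs
      rw [logDeriv_zero, Real.exp_log (hreg.pos_of_pos hθ' (Ioo_subset_Icc_self hs) h)]
    rwa [logDeriv_zero, Real.exp_log h] at h2

theorem IsEnvelope.integrable_law_of_abs_le (hreg : RegularModel μ f a b)
    (hM : IsEnvelope μ f a b M) {θ : ℝ} (hθ : θ ∈ Ioo a b) {p : D → ℝ} (mp : Measurable p)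
    {K : ℝ} (hp : ∀ x, |p x| ≤ K * (1 + M x ^ 4)) : Integrable p (law μ f θ) := by
  have hθ' := Ioo_subset_Icc_self hθ
  obtain ⟨δ, hδ, g, hg, hfg⟩ := hM.dom θ hθ
  rw [integrable_law_iff hreg hθ']
  refine (hg.const_mul K).mono' ((hreg.meas θ hθ').mul mp).aestronglyMeasurable
    (ae_of_all _ fun x => ?_)
  have h0 := hreg.nonneg x θ hθ'
  have h1 := hfg x θ hθ (by simpa using hδ)
  rw [Real.norm_eq_abs, abs_mul, abs_of_nonneg h0]
  calc f x θ * |p x| ≤ g x * (K * (1 + M x ^ 4)) :=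
        mul_le_mul h1 (hp x) (abs_nonneg _) (h0.trans h1)
    _ = _ := by ring

theorem IsEnvelope.memLp (hreg : RegularModel μ f a b) (hM : IsEnvelope μ f a b M) {θ : ℝ}
    (hθ : θ ∈ Ioo a b) : MemLp M 4 (law μ f θ) := by
  have h := hM.integrable_law_of_abs_le hreg hθ (p := fun x => M x ^ 4) (hM.meas.pow_const 4)
    (K := 1) fun x => by rw [abs_of_nonneg (by positivity)]; linarith
  have h2 := (integrable_norm_rpow_iff (p := 4) (μ := law μ f θ) hM.meas.aestronglyMeasurable
    (by norm_num) (by norm_num)).1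
  refine h2 (h.congr (ae_of_all _ fun x => ?_))
  simp [abs_of_nonneg (hM.nonneg x)]

theorem IsEnvelope.memLp_logDeriv (hreg : RegularModel μ f a b) (hM : IsEnvelope μ f a b M)
    {θ : ℝ} (hθ : θ ∈ Ioo a b) {j : ℕ} (h1 : 1 ≤ j) (h4 : j ≤ 4) :
    MemLp (fun x => logDeriv f j x θ) 4 (law μ f θ) :=
  (hM.memLp hreg hθ).mono (measurable_logDeriv hreg h4 hθ).aestronglyMeasurable
    (ae_of_all _ fun x => by
      rw [Real.norm_eq_abs, Real.norm_eq_abs, abs_of_nonneg (hM.nonneg x)]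
      exact hM.abs_le x θ hθ j h1 h4)

/-- Differentiation of an expectation in which both the integrand and the distribution depend on
the parameter. -/
theorem IsEnvelope.hasDerivAt_integral_law (hreg : RegularModel μ f a b)
    (hM : IsEnvelope μ f a b M) {p p' : D → ℝ → ℝ}
    (mp : ∀ θ ∈ Ioo a b, Measurable fun x => p x θ)
    (mp' : ∀ θ ∈ Ioo a b, Measurable fun x => p' x θ)
    (hd : ∀ x, ∀ θ ∈ Ioo a b, HasDerivAt (p x) (p' x θ) θ) {K K' : ℝ}
    (hp : ∀ x, ∀ θ ∈ Ioo a b, |p x θ| ≤ K * (1 + M x ^ 4))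
    (hp' : ∀ x, ∀ θ ∈ Ioo a b, |p' x θ + p x θ * logDeriv f 1 x θ| ≤ K' * (1 + M x ^ 4))
    {θ₀ : ℝ} (hθ₀ : θ₀ ∈ Ioo a b) :
    HasDerivAt (fun θ => ∫ x, p x θ ∂(law μ f θ))
      (∫ x, (p' x θ₀ + p x θ₀ * logDeriv f 1 x θ₀) ∂(law μ f θ₀)) θ₀ := by
  obtain ⟨δ, hδ, g, hg, hfg⟩ := hM.dom θ₀ hθ₀
  have hθ₀' := Ioo_subset_Icc_self hθ₀
  have hs : Ioo a b ∩ Metric.ball θ₀ δ ∈ 𝓝 θ₀ :=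
    inter_mem (isOpen_Ioo.mem_nhds hθ₀) (Metric.ball_mem_nhds θ₀ hδ)
  have key := (hasDerivAt_integral_of_dominated_loc_of_deriv_le (μ := μ)
    (F := fun θ x => f x θ * p x θ)
    (F' := fun θ x => f x θ * (p' x θ + p x θ * logDeriv f 1 x θ))
    (bound := fun x => K' * (g x * (1 + M x ^ 4))) hs ?_ ?_ ?_ ?_ (hg.const_mul K') ?_).2
  · rw [integral_law hreg hθ₀']
    refine key.congr_of_eventuallyEq ?_
    filter_upwards [isOpen_Ioo.mem_nhds hθ₀] with θ hθ
    exact integral_law hreg (Ioo_subset_Icc_self hθ) _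
  · filter_upwards [isOpen_Ioo.mem_nhds hθ₀] with θ hθ
    exact ((hreg.meas θ (Ioo_subset_Icc_self hθ)).mul (mp θ hθ)).aestronglyMeasurable
  · exact (integrable_law_iff hreg hθ₀').1
      (hM.integrable_law_of_abs_le hreg hθ₀ (mp θ₀ hθ₀) fun x => hp x θ₀ hθ₀)
  · exact ((hreg.meas θ₀ hθ₀').mul ((mp' θ₀ hθ₀).add ((mp θ₀ hθ₀).mul
      (measurable_logDeriv hreg (by norm_num) hθ₀)))).aestronglyMeasurable
  · refine ae_of_all _ fun x θ hθ => ?_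
    have h0 := hreg.nonneg x θ (Ioo_subset_Icc_self hθ.1)
    have h1 := hfg x θ hθ.1 (by simpa [Real.dist_eq] using hθ.2)
    rw [Real.norm_eq_abs, abs_mul, abs_of_nonneg h0]
    calc _ ≤ g x * (K' * (1 + M x ^ 4)) :=
          mul_le_mul h1 (hp' x θ hθ.1) (abs_nonneg _) (h0.trans h1)
      _ = _ := by ring
  · refine ae_of_all _ fun x θ hθ => ?_
    exact ((hasDerivAt_density hreg hθ.1 x).mul (hd x θ hθ.1)).congr_deriv (by ring)

theorem IsEnvelope.pow_le (hM : IsEnvelope μ f a b M) (x : D) {j : ℕ} (hj : j ≤ 4) :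
    M x ^ j ≤ 1 + M x ^ 4 := by
  rcases le_total (M x) 1 with h | h
  · exact (pow_le_one₀ (hM.nonneg x) h).trans (by have := pow_nonneg (hM.nonneg x) 4; linarith)
  · exact (pow_le_pow_right₀ h hj).trans (by linarith)

/-- First Bartlett identity: the score is centered. -/
theorem integral_score_eq_zero (hreg : RegularModel μ f a b) {θ : ℝ} (hθ : θ ∈ Ioo a b) :
    ∫ x, logDeriv f 1 x θ ∂(law μ f θ) = 0 := by
  obtain ⟨M, hM⟩ := hreg.exists_isEnvelope
  have h := hM.hasDerivAt_integral_law hreg (p := fun _ _ => 1) (p' := fun _ _ => 0)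
    (K := 1) (K' := 1) (fun _ _ => measurable_const) (fun _ _ => measurable_const)
    (fun x θ _ => hasDerivAt_const θ 1)
    (fun x θ _ => by have := pow_nonneg (hM.nonneg x) 4; simpa using this)
    (fun x θ hθ => by
      have := hM.pow_le x (j := 1) (by norm_num)
      have := hM.abs_le x θ hθ 1 le_rfl (by norm_num)
      simp only [zero_add, one_mul]; linarith) hθ
  simp only [zero_add, one_mul] at h
  refine h.unique ((hasDerivAt_const θ (1 : ℝ)).congr_of_eventuallyEq ?_)
  filter_upwards [isOpen_Ioo.mem_nhds hθ] with s hs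
  have := hreg.prob s (Ioo_subset_Icc_self hs)
  simp

theorem abs_mul_le_envelope {u v m : ℝ} {i j : ℕ} (hu : |u| ≤ m ^ i) (hv : |v| ≤ m ^ j) :
    |u * v| ≤ m ^ (i + j) := by
  rw [abs_mul, pow_add]
  exact mul_le_mul hu hv (abs_nonneg _) ((abs_nonneg _).trans hu)

/-- Second Bartlett identity. -/
theorem integral_logDeriv_two (hreg : RegularModel μ f a b) {θ : ℝ} (hθ : θ ∈ Ioo a b) :
    ∫ x, logDeriv f 2 x θ ∂(law μ f θ) = -fisherInfo μ f θ := by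
  obtain ⟨M, hM⟩ := hreg.exists_isEnvelope
  have b1 : ∀ x, ∀ θ ∈ Ioo a b, |logDeriv f 1 x θ| ≤ M x ^ 1 := fun x θ hθ => by
    simpa using hM.abs_le x θ hθ 1 le_rfl (by norm_num)
  have b2 : ∀ x, ∀ θ ∈ Ioo a b, |logDeriv f 2 x θ| ≤ M x ^ 1 := fun x θ hθ => by
    simpa using hM.abs_le x θ hθ 2 (by norm_num) (by norm_num)
  have h := hM.hasDerivAt_integral_law hreg (p := fun x => logDeriv f 1 x)
    (p' := fun x => logDeriv f 2 x) (K := 1) (K' := 2)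
    (fun θ hθ => measurable_logDeriv hreg (by norm_num) hθ)
    (fun θ hθ => measurable_logDeriv hreg (by norm_num) hθ)
    (fun x θ hθ => hasDerivAt_logDeriv hreg hθ (by norm_num) x)
    (fun x θ hθ => by
      linarith [b1 x θ hθ, hM.pow_le x (j := 1) (by norm_num)])
    (fun x θ hθ => by
      linarith [b2 x θ hθ, abs_mul_le_envelope (b1 x θ hθ) (b1 x θ hθ),
        abs_add_le (logDeriv f 2 x θ) (logDeriv f 1 x θ * logDeriv f 1 x θ),
        hM.pow_le x (j := 1) (by norm_num), hM.pow_le x (j := 1 + 1) (by norm_num)]) hθ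
  have h0 := h.unique ((hasDerivAt_const θ (0 : ℝ)).congr_of_eventuallyEq (by
    filter_upwards [isOpen_Ioo.mem_nhds hθ] with s hs
    exact integral_score_eq_zero hreg hs))
  have := hreg.prob θ (Ioo_subset_Icc_self hθ)
  have i1 := integrable_pow_of_memLp_four (j := 2)
    (hM.memLp_logDeriv hreg hθ le_rfl (by norm_num : 1 ≤ 4)) (by norm_num)
  have i2 := (hM.memLp_logDeriv hreg hθ (j := 2) (by norm_num) (by norm_num)).integrable
    (by norm_num)
  simp_rw [← sq] at h0
  rw [integral_add i2 i1] at h0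
  rw [fisherInfo]
  linarith

theorem differentiableAt_fisherInfo (hreg : RegularModel μ f a b) {θ : ℝ} (hθ : θ ∈ Ioo a b) :
    DifferentiableAt ℝ (fisherInfo μ f) θ := by
  obtain ⟨M, hM⟩ := hreg.exists_isEnvelope
  have b : ∀ j, 1 ≤ j → j ≤ 4 → ∀ x, ∀ θ ∈ Ioo a b, |logDeriv f j x θ| ≤ M x ^ 1 :=
    fun j h1 h4 x θ hθ => by simpa using hM.abs_le x θ hθ j h1 h4
  have ml : ∀ j, j ≤ 4 → ∀ θ ∈ Ioo a _, Measurable fun x => logDeriv f j x θ :=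
    fun j hj θ hθ => measurable_logDeriv hreg hj hθ
  refine (hM.hasDerivAt_integral_law hreg (p := fun x θ => logDeriv f 1 x θ ^ 2)
    (p' := fun x θ => 2 * (logDeriv f 1 x θ * logDeriv f 2 x θ)) (K := 1) (K' := 3)
    (fun θ hθ => (ml 1 (by norm_num) θ hθ).pow_const 2)
    (fun θ hθ => ((ml 1 (by norm_num) θ hθ).mul (ml 2 (by norm_num) θ hθ)).const_mul 2)
    (fun x θ hθ => ((hasDerivAt_logDeriv hreg hθ (j := 1) (by norm_num) x).pow 2).congr_deriv
      (by norm_num; ring))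
    (fun x θ hθ => ?_) (fun x θ hθ => ?_) hθ).differentiableAt
  · have h1 := b 1 (by norm_num) (by norm_num) x θ hθ
    rw [sq]
    linarith [abs_mul_le_envelope h1 h1, hM.pow_le x (j := 1 + 1) (by norm_num)]
  · have h1 := b 1 (by norm_num) (by norm_num) x θ hθ
    have h2 := b 2 (by norm_num) (by norm_num) x θ hθ
    have t1 := abs_add_le (2 * (logDeriv f 1 x θ * logDeriv f 2 x θ))
      (logDeriv f 1 x θ ^ 2 * logDeriv f 1 x θ)
    rw [abs_mul 2, abs_two, sq] at t1
    rw [sq]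
    linarith [abs_mul_le_envelope h1 h2, abs_mul_le_envelope (abs_mul_le_envelope h1 h1) h1,
      hM.pow_le x (j := 1 + 1) (by norm_num), hM.pow_le x (j := 1 + 1 + 1) (by norm_num)]

theorem differentiableAt_biasCoeff (hreg : RegularModel μ f a b) {θ : ℝ} (hθ : θ ∈ Ioo a b) :
    DifferentiableAt ℝ (biasCoeff μ f) θ := by
  obtain ⟨M, hM⟩ := hreg.exists_isEnvelope
  have b : ∀ j, 1 ≤ j → j ≤ 4 → ∀ x, ∀ θ ∈ Ioo a b, |logDeriv f j x θ| ≤ M x ^ 1 :=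
    fun j h1 h4 x θ hθ => by simpa using hM.abs_le x θ hθ j h1 h4
  have ml : ∀ j, j ≤ 4 → ∀ θ ∈ Ioo a _, Measurable fun x => logDeriv f j x θ :=
    fun j hj θ hθ => measurable_logDeriv hreg hj hθ
  have d1 := (hM.hasDerivAt_integral_law hreg
    (p := fun x θ => logDeriv f 1 x θ * logDeriv f 2 x θ)
    (p' := fun x θ => logDeriv f 2 x θ * logDeriv f 2 x θ + logDeriv f 1 x θ * logDeriv f 3 x θ)
    (K := 1) (K' := 3)
    (fun θ hθ => (ml 1 (by norm_num) θ hθ).mul (ml 2 (by norm_num) θ hθ))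
    (fun θ hθ => ((ml 2 (by norm_num) θ hθ).mul (ml 2 (by norm_num) θ hθ)).add
      ((ml 1 (by norm_num) θ hθ).mul (ml 3 (by norm_num) θ hθ)))
    (fun x θ hθ => (hasDerivAt_logDeriv hreg hθ (j := 1) (by norm_num) x).mul
      (hasDerivAt_logDeriv hreg hθ (j := 2) (by norm_num) x))
    (fun x θ hθ => by
      have h1 := b 1 (by norm_num) (by norm_num) x θ hθ
      have h2 := b 2 (by norm_num) (by norm_num) x θ hθ
      linarith [abs_mul_le_envelope h1 h2, hM.pow_le x (j := 1 + 1) (by norm_num)])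
    (fun x θ hθ => by
      have h1 := b 1 (by norm_num) (by norm_num) x θ hθ
      have h2 := b 2 (by norm_num) (by norm_num) x θ hθ
      have h3 := b 3 (by norm_num) (by norm_num) x θ hθ
      linarith [abs_mul_le_envelope h2 h2, abs_mul_le_envelope h1 h3,
        abs_mul_le_envelope (abs_mul_le_envelope h1 h2) h1,
        abs_add_three (logDeriv f 2 x θ * logDeriv f 2 x θ)
          (logDeriv f 1 x θ * logDeriv f 3 x θ)
          (logDeriv f 1 x θ * logDeriv f 2 x θ * logDeriv f 1 x θ),
        hM.pow_le x (j := 1 + 1) (by norm_num), hM.pow_le x (j := 1 + 1 + 1) (by norm_num)])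
    hθ).differentiableAt
  have d2 := (hM.hasDerivAt_integral_law hreg (p := fun x θ => logDeriv f 3 x θ)
    (p' := fun x θ => logDeriv f 4 x θ) (K := 1) (K' := 2)
    (ml 3 (by norm_num)) (ml 4 (by norm_num))
    (fun x θ hθ => hasDerivAt_logDeriv hreg hθ (j := 3) (by norm_num) x)
    (fun x θ hθ => by
      linarith [b 3 (by norm_num) (by norm_num) x θ hθ, hM.pow_le x (j := 1) (by norm_num)])
    (fun x θ hθ => by
      have h1 := b 1 (by norm_num) (by norm_num) x θ hθ
      have h3 := b 3 (by norm_num) (by norm_num) x θ hθ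
      have h4 := b 4 (by norm_num) (by norm_num) x θ hθ
      linarith [abs_mul_le_envelope h3 h1,
        abs_add_le (logDeriv f 4 x θ) (logDeriv f 3 x θ * logDeriv f 1 x θ),
        hM.pow_le x (j := 1) (by norm_num), hM.pow_le x (j := 1 + 1) (by norm_num)])
    hθ).differentiableAt
  have h0 := (hreg.fisher_pos θ hθ).ne'
  exact ((d1.const_mul 2).add d2).div (((differentiableAt_fisherInfo hreg hθ).pow 2).const_mul 2)
    (by positivity)

theorem measurable_indicator_biasCoeff (hreg : RegularModel μ f a b) :
    Measurable ((Ioo a b).indicator (biasCoeff μ f)) := by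
  have h : ContinuousOn (biasCoeff μ f) (Ioo a b) := fun θ hθ =>
    (differentiableAt_biasCoeff hreg hθ).continuousAt.continuousWithinAt
  rw [← piecewise_eq_indicator]
  exact h.measurable_piecewise (g := 0) continuousOn_const measurableSet_Ioo

theorem exists_abs_biasCoeff_sub_le (hreg : RegularModel μ f a b) {θ : ℝ} (hθ : θ ∈ Ioo a b) :
    ∃ δ > 0, ∃ K, 0 ≤ K ∧ ∀ s, |s - θ| < δ →
      |biasCoeff μ f s - biasCoeff μ f θ| ≤ K * |s - θ| := by
  have h := (differentiableAt_biasCoeff hreg hθ).isBigO_sub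
  obtain ⟨K, hK, h⟩ := h.exists_nonneg
  obtain ⟨δ, hδ, h⟩ := Metric.eventually_nhds_iff.1 h.bound
  exact ⟨δ, hδ, K, hK, fun s hs => h hs⟩

end Model

/-! ### Consistency of the maximum likelihood estimator -/

section Consistency

variable {D : Type*} [MeasurableSpace D] {μ : Measure D} {f : D → ℝ → ℝ} {a b : ℝ} {M : D → ℝ}

theorem IsEnvelope.abs_log_sub_le (hreg : RegularModel μ f a b) (hM : IsEnvelope μ f a b M)
    {x : D} {θ θ' : ℝ} (hθ : θ ∈ Icc a b) (hθ' : θ' ∈ Icc a b) (hx : 0 < f x θ) :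
    |Real.log (f x θ') - Real.log (f x θ)| ≤ M x * |θ' - θ| := by
  wlog h : θ < θ' generalizing θ θ'
  · rcases (not_lt.1 h).eq_or_lt with h | h
    · simp [h]
    · rw [abs_sub_comm, abs_sub_comm θ']
      exact this hθ' hθ (hreg.pos_of_pos hθ hθ' hx) h
  have hsub : Icc θ θ' ⊆ Icc a b := Icc_subset_Icc hθ.1 hθ'.2
  have hsub' : Ioo θ θ' ⊆ Ioo a b := Ioo_subset_Ioo hθ.1 hθ'.2
  obtain ⟨c, hc, hc'⟩ := exists_hasDerivAt_eq_slope (fun s => Real.log (f x s))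
    (fun s => logDeriv f 1 x s) h
    (((hreg.cont x).mono hsub).log fun s hs => (hreg.pos_of_pos hθ (hsub hs) hx).ne')
    fun s hs => by
      have := hasDerivAt_logDeriv hreg (hsub' hs) (j := 0) (by norm_num) x
      refine this.congr_of_eventuallyEq (Eventually.of_forall fun s => ?_)
      exact (logDeriv_zero x s).symm
  have h1 := hM.abs_le x c (hsub' hc) 1 le_rfl (by norm_num)
  rw [hc', abs_div, div_le_iff₀ (abs_pos.2 (sub_ne_zero.2 h.ne'))] at h1
  exact h1

theorem memLp_log_sub (hreg : RegularModel μ f a b) {θ₀ θ : ℝ} (hθ₀ : θ₀ ∈ Ioo a b)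
    (hθ : θ ∈ Icc a b) :
    MemLp (fun x => Real.log (f x θ) - Real.log (f x θ₀)) 4 (law μ f θ₀) := by
  obtain ⟨M, hM⟩ := hreg.exists_isEnvelope
  have hθ₀' := Ioo_subset_Icc_self hθ₀
  refine ((hM.memLp hreg hθ₀).mul_const |θ - θ₀|).mono
    ((hreg.meas θ hθ).log.sub (hreg.meas θ₀ hθ₀').log).aestronglyMeasurable ?_
  filter_upwards [ae_law_pos hreg hθ₀'] with x hx
  rw [Real.norm_eq_abs, Real.norm_eq_abs, abs_of_nonneg (a := M x * |θ - θ₀|)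
    (mul_nonneg (hM.nonneg x) (abs_nonneg _))]
  exact hM.abs_log_sub_le hreg hθ₀' hθ hx

/-- Gibbs' inequality: the expected log-likelihood has a strict maximum at the true parameter. -/
theorem integral_log_sub_neg (hreg : RegularModel μ f a b) {θ₀ θ : ℝ} (hθ₀ : θ₀ ∈ Ioo a b)
    (hθ : θ ∈ Icc a b) (hne : θ ≠ θ₀) :
    ∫ x, (Real.log (f x θ) - Real.log (f x θ₀)) ∂(law μ f θ₀) < 0 := by
  have hθ₀' := Ioo_subset_Icc_self hθ₀
  have := hreg.prob θ₀ hθ₀'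
  have := hreg.prob θ hθ
  by_contra hcon
  have e : ∀ x, f x θ₀ * (f x θ / f x θ₀) = f x θ := fun x => by
    by_cases h : f x θ₀ = 0
    · rw [h, hreg.common_support x θ₀ hθ₀' θ hθ h, zero_mul]
    · field_simp
  have i1 : Integrable (fun x => f x θ / f x θ₀) (law μ f θ₀) := by
    rw [integrable_law_iff hreg hθ₀']
    simp_rw [e]
    simpa using (integrable_law_iff hreg hθ).1 (integrable_const (1 : ℝ))
  have v1 : ∫ x, f x θ / f x θ₀ ∂(law μ f θ₀) = 1 := by
    rw [integral_law hreg hθ₀']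
    simp_rw [e]
    simpa using (integral_law hreg hθ (fun _ => (1 : ℝ))).symm
  have i2 := (memLp_log_sub hreg hθ₀ hθ).integrable (by norm_num)
  set φ : D → ℝ := fun x =>
    f x θ / f x θ₀ - 1 - (Real.log (f x θ) - Real.log (f x θ₀)) with hφ
  have i1' : Integrable (fun x => f x θ / f x θ₀ - 1) (law μ f θ₀) := i1.sub (integrable_const 1)
  have i3 : Integrable φ (law μ f θ₀) := i1'.sub i2
  have hφ0 : 0 ≤ᵐ[law μ f θ₀] φ := by
    filter_upwards [ae_law_pos hreg hθ₀'] with x hx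
    have hx' := hreg.pos_of_pos hθ₀' hθ hx
    have := Real.log_le_sub_one_of_pos (div_pos hx' hx)
    rw [Real.log_div hx'.ne' hx.ne'] at this
    simp only [hφ, Pi.zero_apply]
    linarith
  have v3 : ∫ x, φ x ∂(law μ f θ₀) ≤ 0 := by
    simp only [hφ]
    rw [integral_sub i1' i2, integral_sub i1 (integrable_const 1),
      v1]
    simp only [integral_const, probReal_univ, one_smul, sub_self, zero_sub]
    linarith [not_lt.1 hcon]
  have hz := (integral_eq_zero_iff_of_nonneg_ae hφ0 i3).1
    (le_antisymm v3 (integral_nonneg_of_ae hφ0))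
  have hz' : ∀ᵐ x ∂(law μ f θ₀), f x θ = f x θ₀ := by
    filter_upwards [hz, ae_law_pos hreg hθ₀'] with x h0 hx
    by_contra hc
    have hx' := hreg.pos_of_pos hθ₀' hθ hx
    have := Real.log_lt_sub_one_of_pos (div_pos hx' hx) (by rwa [Ne, div_eq_one_iff_eq hx.ne'])
    rw [Real.log_div hx'.ne' hx.ne'] at this
    simp only [hφ, Pi.zero_apply] at h0
    linarith
  rw [law, ae_withDensity_iff (hreg.meas θ₀ hθ₀').ennreal_ofReal] at hz'
  refine hne (hreg.identifiable θ hθ θ₀ hθ₀' ?_)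
  refine withDensity_congr_ae ?_
  filter_upwards [hz'] with x hx
  by_cases h : f x θ₀ = 0
  · rw [h, hreg.common_support x θ₀ hθ₀' θ hθ h]
  · rw [hx fun h' => h (le_antisymm (ENNReal.ofReal_eq_zero.1 h') (hreg.nonneg x θ₀ hθ₀'))]

theorem isProbabilityMeasure_sampleLaw (hreg : RegularModel μ f a b) {θ : ℝ}
    (hθ : θ ∈ Icc a b) (n : ℕ) : IsProbabilityMeasure (sampleLaw μ f n θ) := by
  have := hreg.prob θ hθ
  unfold sampleLaw; infer_instance

theorem ae_sampleLaw_pos (hreg : RegularModel μ f a b) {θ : ℝ} (hθ : θ ∈ Icc a b) (n : ℕ) :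
    ∀ᵐ x ∂(sampleLaw μ f n θ), ∀ i, 0 < f (x i) θ := by
  have := hreg.prob θ hθ
  refine ae_all_iff.2 fun i => ?_
  exact (measurePreserving_eval (fun _ : Fin n => law μ f θ) i).quasiMeasurePreserving.ae
    (ae_law_pos hreg hθ)

theorem IsMLE.sum_log_le {mle : ∀ n : ℕ, (Fin n → D) → ℝ} (hmle : IsMLE f a b mle)
    (hreg : RegularModel μ f a b) {n : ℕ} {x : Fin n → D} {θ₀ θ : ℝ} (hθ₀ : θ₀ ∈ Icc a b)
    (hθ : θ ∈ Icc a b) (hx : ∀ i, 0 < f (x i) θ₀) :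
    ∑ i, Real.log (f (x i) θ) ≤ ∑ i, Real.log (f (x i) (mle n x)) := by
  obtain ⟨h1, h2⟩ := (hmle n).2 x
  have p : ∀ s ∈ Icc a b, ∀ i, 0 < f (x i) s := fun s hs i => hreg.pos_of_pos hθ₀ hs (hx i)
  rw [← Real.log_prod fun i _ => (p θ hθ i).ne', ← Real.log_prod fun i _ => (p _ h1 i).ne']
  exact Real.log_le_log (Finset.prod_pos fun i _ => p θ hθ i) (h2 θ hθ)

/-- The MLE leaves a neighborhood of the true parameter with probability `O(n⁻²)`. Compactness of
the parameter space reduces this to a neighborhood of one wrong parameter, where the law of large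
numbers applies to the log-likelihood ratio and to the Lipschitz constant `M`. -/
theorem IsMLE.exists_measureReal_abs_sub_ge_le {mle : ∀ n : ℕ, (Fin n → D) → ℝ}
    (hmle : IsMLE f a b mle) (hreg : RegularModel μ f a b) {θ₀ : ℝ} (hθ₀ : θ₀ ∈ Ioo a b)
    {δ : ℝ} (hδ : 0 < δ) : ∃ C : ℝ, ∀ n : ℕ, 1 ≤ n →
      (sampleLaw μ f n θ₀).real {x | δ ≤ |mle n x - θ₀|} ≤ C / (n : ℝ) ^ 2 := by
  obtain ⟨M, hM⟩ := hreg.exists_isEnvelope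
  have hθ₀' := Ioo_subset_Icc_self hθ₀
  have hP := hreg.prob θ₀ hθ₀'
  have hPn := isProbabilityMeasure_sampleLaw hreg hθ₀'
  have hcomp : IsCompact (Icc a b ∩ {θ | δ ≤ |θ - θ₀|}) :=
    isCompact_Icc.inter_right (isClosed_le continuous_const (by fun_prop))
  have key : ∃ C : ℝ, ∀ n : ℕ, 1 ≤ n →
      (sampleLaw μ f n θ₀).real {x | mle n x ∈ Icc a b ∩ {θ | δ ≤ |θ - θ₀|}}
        ≤ C / (n : ℝ) ^ 2 := by
    refine hcomp.induction_on (p := fun s => ∃ C : ℝ, ∀ n : ℕ, 1 ≤ n →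
      (sampleLaw μ f n θ₀).real {x | mle n x ∈ s} ≤ C / (n : ℝ) ^ 2) ⟨0, fun n _ => by simp⟩
      ?_ ?_ ?_
    · rintro s t hst ⟨C, hC⟩
      refine ⟨C, fun n hn => le_trans ?_ (hC n hn)⟩
      exact measureReal_mono fun x hx => hst hx
    · rintro s t ⟨C, hC⟩ ⟨C', hC'⟩
      refine ⟨C + C', fun n hn => ?_⟩
      rw [add_div]
      exact (measureReal_union_le {x | mle n x ∈ s} {x | mle n x ∈ t}).trans
        (add_le_add (hC n hn) (hC' n hn))
    · rintro θ ⟨hθ, hδθ⟩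
      have hne : θ ≠ θ₀ := fun h => by simp [h] at hδθ; linarith
      set Y : D → ℝ := fun x => Real.log (f x θ) - Real.log (f x θ₀) with hY
      have mY : Measurable Y := (hreg.meas θ hθ).log.sub (hreg.meas θ₀ hθ₀').log
      set c : ℝ := -∫ x, Y x ∂(law μ f θ₀) with hc
      have hc0 : 0 < c := neg_pos.2 (integral_log_sub_neg hreg hθ₀ hθ hne)
      set m : ℝ := ∫ x, M x ∂(law μ f θ₀) with hm
      have hm0 : 0 ≤ m := integral_nonneg hM.nonneg
      obtain ⟨C, hC⟩ := exists_measureReal_abs_empMean_sub_ge_le mY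
        (memLp_log_sub hreg hθ₀ hθ) (half_pos hc0)
      obtain ⟨C', hC'⟩ := exists_measureReal_abs_empMean_sub_ge_le hM.meas
        (hM.memLp hreg hθ₀) one_pos
      set r : ℝ := c / (4 * (m + 1)) with hr
      have hr0 : 0 < r := by positivity
      refine ⟨Icc a b ∩ Metric.ball θ r ∩ {θ | δ ≤ |θ - θ₀|}, ?_, C + C', fun n hn => ?_⟩
      · rw [inter_right_comm]
        exact inter_mem self_mem_nhdsWithin
          (mem_nhdsWithin_of_mem_nhds (Metric.ball_mem_nhds θ hr0))
      rw [add_div]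
      refine le_trans ?_ (add_le_add (hC n hn) (hC' n hn))
      refine le_trans ?_ (measureReal_union_le _ _)
      refine ENNReal.toReal_mono (measure_ne_top _ _) (measure_mono_ae ?_)
      filter_upwards [ae_sampleLaw_pos hreg hθ₀' n] with x hx hx1
      have hx2 : mle n x ∈ Icc a b ∧ |mle n x - θ| < r :=
        ⟨hx1.1.1, by simpa [Real.dist_eq] using hx1.1.2⟩
      by_contra hcon
      have hcon' : |empMean n Y x - -c| < c / 2 ∧ |empMean n M x - m| < 1 := by
        have h1 : x ∉ _ := fun h => hcon (Or.inl h)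
        have h2 : x ∉ _ := fun h => hcon (Or.inr h)
        simp only [mem_ofPred_eq, not_le] at h1 h2
        refine ⟨?_, h2⟩
        rwa [hc, neg_neg]
      have hn' : (0 : ℝ) < n := by exact_mod_cast hn
      have s1 := hmle.sum_log_le hreg hθ₀' hθ₀' hx
      have s2 : ∑ i, (Real.log (f (x i) (mle n x)) - Real.log (f (x i) θ)) ≤ ∑ i, M (x i) * r :=
        Finset.sum_le_sum fun i _ => (le_abs_self _).trans
          ((hM.abs_log_sub_le hreg hθ hx2.1 (hreg.pos_of_pos hθ₀' hθ (hx i))).trans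
            (mul_le_mul_of_nonneg_left hx2.2.le (hM.nonneg _)))
      have s3 : 0 ≤ empMean n Y x + empMean n M x * r := by
        simp only [empMean]
        rw [div_mul_eq_mul_div, ← add_div]
        refine div_nonneg ?_ hn'.le
        rw [Finset.sum_mul, hY]
        simp only [Finset.sum_sub_distrib] at s2 ⊢
        linarith
      have s4 : empMean n M x * r ≤ (m + 1) * r :=
        mul_le_mul_of_nonneg_right (by linarith [(abs_lt.1 hcon'.2).2]) hr0.le
      have s5 : (m + 1) * r = c / 4 := by rw [hr]; field_simp
      linarith [(abs_lt.1 hcon'.1).2]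
  obtain ⟨C, hC⟩ := key
  refine ⟨C, fun n hn => le_trans ?_ (hC n hn)⟩
  exact measureReal_mono fun x hx => ⟨((hmle n).2 x).1, hx⟩

/-! ### Existence of a measurable maximum likelihood estimator -/

/-- A function that is measurable in the data and continuous in a parameter from a compact
interval has a measurable maximizer, namely the leftmost one. -/
theorem exists_measurable_argmax {X : Type*} [MeasurableSpace X] {L : X → ℝ → ℝ} {a b : ℝ}
    (hab : a ≤ b) (hm : ∀ θ ∈ Icc a b, Measurable fun x => L x θ)
    (hc : ∀ x, ContinuousOn (L x) (Icc a b)) :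
    ∃ T : X → ℝ, Measurable T ∧ ∀ x, T x ∈ Icc a b ∧ ∀ θ ∈ Icc a b, L x θ ≤ L x (T x) := by
  set S : X → Set ℝ := fun x => {θ | θ ∈ Icc a b ∧ ∀ s ∈ Icc a b, L x s ≤ L x θ} with hS
  have hne : ∀ x, (S x).Nonempty := fun x => by
    obtain ⟨θ, h1, h2⟩ := isCompact_Icc.exists_isMaxOn (nonempty_Icc.2 hab) (hc x)
    exact ⟨θ, h1, fun s hs => h2 hs⟩
  have hbdd : ∀ x, BddBelow (S x) := fun x => ⟨a, fun θ h => h.1.1⟩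
  have hmem : ∀ x, sInf (S x) ∈ S x := fun x => by
    refine IsClosed.csInf_mem ?_ (hne x) (hbdd x)
    obtain ⟨θ, h1, h2⟩ := hne x
    have : S x = Icc a b ∩ L x ⁻¹' Ici (L x θ) := by
      ext s
      exact ⟨fun h => ⟨h.1, h.2 θ h1⟩, fun h => ⟨h.1, fun s hs => (h2 s hs).trans h.2⟩⟩
    rw [this]
    exact (hc x).preimage_isClosed_of_isClosed isClosed_Icc isClosed_Ici
  refine ⟨fun x => sInf (S x), ?_, hmem⟩
  -- `T ≤ c` iff the maximum over `[a, c]` is at least the value at every point of a dense set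
  have hdense : ∀ c d : ℝ, ∃ Q : Set ℝ, Q.Countable ∧ Q ⊆ Icc c d ∧ Icc c d ⊆ closure Q :=
    fun c d => by
      obtain ⟨Q, h1, h2, h3⟩ := (TopologicalSpace.IsSeparable.of_separableSpace
        (Icc c d)).exists_countable_dense_subset
      exact ⟨Q, h2, h1, h3⟩
  obtain ⟨Q, hQc, hQs, hQd⟩ := hdense a b
  refine measurable_of_Iic fun c => ?_
  rcases lt_or_ge c a with hca | hca
  · convert MeasurableSet.empty
    ext x
    simp only [mem_preimage, mem_Iic, mem_empty_iff_false, iff_false, not_le]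
    exact hca.trans_le (hmem x).1.1
  obtain ⟨R, hRc, hRs, hRd⟩ := hdense a (min b c)
  have hle : a ≤ min b c := le_min hab hca
  have hRsub : Icc a (min b c) ⊆ Icc a b := Icc_subset_Icc_right (min_le_left _ _)
  have e : (fun x => sInf (S x)) ⁻¹' Iic c
      = ⋂ q ∈ Q, ⋂ k : ℕ, ⋃ r ∈ R, {x | L x q < L x r + 1 / ((k : ℝ) + 1)} := by
    ext x
    simp only [mem_preimage, mem_Iic, mem_iInter, mem_iUnion, exists_prop, mem_ofPred_eq]
    constructor
    · intro h q hq k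
      have hT : sInf (S x) ∈ Icc a (min b c) := ⟨(hmem x).1.1, le_min (hmem x).1.2 h⟩
      have h1 := (hmem x).2 q (hQs hq)
      have hcl := hRd hT
      have hcont : ContinuousWithinAt (L x) R (sInf (S x)) :=
        ((hc x) _ (hmem x).1).mono (hRs.trans hRsub)
      have hev : ∀ᶠ r in 𝓝[R] sInf (S x), L x (sInf (S x)) - 1 / ((k : ℝ) + 1) < L x r :=
        hcont.eventually_const_lt (sub_lt_self _ (by positivity))
      have := mem_closure_iff_nhdsWithin_neBot.1 hcl
      obtain ⟨r, hr, hr'⟩ := (hev.and self_mem_nhdsWithin).exists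
      exact ⟨r, hr', by linarith⟩
    · intro h
      obtain ⟨θ, h1, h2⟩ := isCompact_Icc.exists_isMaxOn (nonempty_Icc.2 hle)
        ((hc x).mono hRsub)
      refine (csInf_le (hbdd x) ?_).trans (h1.2.trans (min_le_right _ _))
      refine ⟨hRsub h1, fun s hs => ?_⟩
      have hQ : ∀ q ∈ Q, L x q ≤ L x θ := fun q hq => by
        by_contra hlt
        obtain ⟨k, hk⟩ := exists_nat_one_div_lt (sub_pos.2 (not_le.1 hlt))
        obtain ⟨r, hr, hr'⟩ := h q hq k
        have : L x r ≤ L x θ := h2 (hRs hr)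
        linarith
      exact (closure_minimal (t := Icc a b ∩ L x ⁻¹' Iic (L x θ))
        (fun q hq => ⟨hQs hq, hQ q hq⟩)
        ((hc x).preimage_isClosed_of_isClosed isClosed_Icc isClosed_Iic) (hQd hs)).2
  rw [e]
  refine MeasurableSet.biInter hQc fun q hq => MeasurableSet.iInter fun k =>
    MeasurableSet.biUnion hRc fun r hr => ?_
  exact measurableSet_lt (hm q (hQs hq)) ((hm r (hRsub (hRs hr))).add_const _)

theorem exists_isMLE (hreg : RegularModel μ f a b) :
    ∃ mle : ∀ n : ℕ, (Fin n → D) → ℝ, IsMLE f a b mle := by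
  have h : ∀ n : ℕ, ∃ T : (Fin n → D) → ℝ, Measurable T ∧ ∀ x, T x ∈ Icc a b ∧
      ∀ θ ∈ Icc a b, ∏ i, f (x i) θ ≤ ∏ i, f (x i) (T x) := fun n =>
    exists_measurable_argmax (L := fun (x : Fin n → D) θ => ∏ i, f (x i) θ) hreg.lt.le
      (fun θ hθ => Finset.measurable_fun_prod _ fun i _ =>
        (hreg.meas θ hθ).comp (measurable_pi_apply i))
      (fun x => continuousOn_finsetProd _ fun i _ => hreg.cont (x i))
  choose T hT using h
  exact ⟨T, hT⟩

end Consistency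

/-! ### Stochastic expansion of the estimators -/

/-- Integrating a bound on a derivative that vanishes to order `k` at `θ₀`. -/
theorem abs_sub_le_of_abs_deriv_le_pow {g g' : ℝ → ℝ} {θ₀ θ m : ℝ} (hm : 0 ≤ m) {k : ℕ}
    (hd : ∀ s ∈ uIcc θ₀ θ, HasDerivAt g (g' s) s)
    (hb : ∀ s ∈ uIcc θ₀ θ, |g' s| ≤ m * |s - θ₀| ^ k) :
    |g θ - g θ₀| ≤ m * |θ - θ₀| ^ (k + 1) := by
  have h := (convex_uIcc θ₀ θ).norm_image_sub_le_of_norm_hasDerivWithin_le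
    (f := g) (f' := g') (C := m * |θ - θ₀| ^ k) (fun s hs => (hd s hs).hasDerivWithinAt)
    (fun s hs => (hb s hs).trans (mul_le_mul_of_nonneg_left
      (pow_le_pow_left₀ (abs_nonneg _) (abs_sub_left_of_mem_uIcc hs) k) hm))
    left_mem_uIcc right_mem_uIcc
  rw [pow_succ, ← mul_assoc]
  exact h

section Taylor

variable {D : Type*} [MeasurableSpace D] {μ : Measure D} {f : D → ℝ → ℝ} {a b : ℝ} {M : D → ℝ}

theorem uIcc_subset_Ioo {θ₀ θ : ℝ} (h₀ : θ₀ ∈ Ioo a b) (h : θ ∈ Ioo a b) :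
    uIcc θ₀ θ ⊆ Ioo a b := by
  exact ordConnected_Ioo.uIcc_subset h₀ h

theorem IsEnvelope.taylor_one (hreg : RegularModel μ f a b) (hM : IsEnvelope μ f a b M)
    {θ₀ θ : ℝ} (h₀ : θ₀ ∈ Ioo a b) (h : θ ∈ Ioo a b) (x : D) :
    |logDeriv f 1 x θ - logDeriv f 1 x θ₀ - logDeriv f 2 x θ₀ * (θ - θ₀)|
      ≤ M x * |θ - θ₀| ^ 2 := by
  have h2 : ∀ s ∈ Ioo a b, |logDeriv f 2 x s - logDeriv f 2 x θ₀| ≤ M x * |s - θ₀| ^ 1 :=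
    fun s hs => abs_sub_le_of_abs_deriv_le_pow (k := 0) (hM.nonneg x)
      (fun t ht => hasDerivAt_logDeriv hreg (uIcc_subset_Ioo h₀ hs ht) (by norm_num) x)
      (fun t ht => by
        simpa using hM.abs_le x t (uIcc_subset_Ioo h₀ hs ht) 3 (by norm_num) (by norm_num))
  have h1 := abs_sub_le_of_abs_deriv_le_pow (k := 1) (θ₀ := θ₀) (θ := θ) (hM.nonneg x)
    (g := fun s => logDeriv f 1 x s - logDeriv f 2 x θ₀ * (s - θ₀))
    (g' := fun s => logDeriv f 2 x s - logDeriv f 2 x θ₀)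
    (fun t ht => ((hasDerivAt_logDeriv hreg (uIcc_subset_Ioo h₀ h ht) (by norm_num) x).sub
      (((hasDerivAt_id t).sub_const θ₀).const_mul (logDeriv f 2 x θ₀))).congr_deriv (by simp))
    (fun t ht => h2 t (uIcc_subset_Ioo h₀ h ht))
  convert h1 using 2
  ring

theorem IsEnvelope.taylor_two (hreg : RegularModel μ f a b) (hM : IsEnvelope μ f a b M)
    {θ₀ θ : ℝ} (h₀ : θ₀ ∈ Ioo a b) (h : θ ∈ Ioo a b) (x : D) :
    |logDeriv f 1 x θ - logDeriv f 1 x θ₀ - logDeriv f 2 x θ₀ * (θ - θ₀)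
        - logDeriv f 3 x θ₀ / 2 * (θ - θ₀) ^ 2| ≤ M x * |θ - θ₀| ^ 3 := by
  have h3 : ∀ s ∈ Ioo a b, |logDeriv f 3 x s - logDeriv f 3 x θ₀| ≤ M x * |s - θ₀| ^ 1 :=
    fun s hs => abs_sub_le_of_abs_deriv_le_pow (k := 0) (hM.nonneg x)
      (fun t ht => hasDerivAt_logDeriv hreg (uIcc_subset_Ioo h₀ hs ht) (by norm_num) x)
      (fun t ht => by
        simpa using hM.abs_le x t (uIcc_subset_Ioo h₀ hs ht) 4 (by norm_num) (by norm_num))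
  have h2 : ∀ s ∈ Ioo a b, |logDeriv f 2 x s - logDeriv f 2 x θ₀
      - logDeriv f 3 x θ₀ * (s - θ₀)| ≤ M x * |s - θ₀| ^ 2 := fun s hs => by
    have := abs_sub_le_of_abs_deriv_le_pow (k := 1) (θ₀ := θ₀) (θ := s) (hM.nonneg x)
      (g := fun s => logDeriv f 2 x s - logDeriv f 3 x θ₀ * (s - θ₀))
      (g' := fun s => logDeriv f 3 x s - logDeriv f 3 x θ₀)
      (fun t ht => ((hasDerivAt_logDeriv hreg (uIcc_subset_Ioo h₀ hs ht) (by norm_num) x).sub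
        (((hasDerivAt_id t).sub_const θ₀).const_mul (logDeriv f 3 x θ₀))).congr_deriv (by simp))
      (fun t ht => h3 t (uIcc_subset_Ioo h₀ hs ht))
    convert this using 2
    ring
  have h1 := abs_sub_le_of_abs_deriv_le_pow (k := 2) (θ₀ := θ₀) (θ := θ) (hM.nonneg x)
    (g := fun s => logDeriv f 1 x s - logDeriv f 2 x θ₀ * (s - θ₀)
      - logDeriv f 3 x θ₀ / 2 * (s - θ₀) ^ 2)
    (g' := fun s => logDeriv f 2 x s - logDeriv f 2 x θ₀ - logDeriv f 3 x θ₀ * (s - θ₀))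
    (fun t ht => (((hasDerivAt_logDeriv hreg (uIcc_subset_Ioo h₀ h ht) (by norm_num) x).sub
      (((hasDerivAt_id t).sub_const θ₀).const_mul (logDeriv f 2 x θ₀))).sub
      ((((hasDerivAt_id t).sub_const θ₀).pow 2).const_mul (logDeriv f 3 x θ₀ / 2))).congr_deriv
        (by simp; ring))
    (fun t ht => h2 t (uIcc_subset_Ioo h₀ h ht))
  convert h1 using 2
  ring

end Taylor

theorem abs_mul_le_mul_pow {x y p q u : ℝ} {i j k : ℕ} (hx : |x| ≤ p * u ^ i)
    (hy : |y| ≤ q * u ^ j) (hk : k = i + j) : |x * y| ≤ p * q * u ^ k := by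
  rw [abs_mul, hk, pow_add]
  calc |x| * |y| ≤ (p * u ^ i) * (q * u ^ j) :=
        mul_le_mul hx hy (abs_nonneg _) ((abs_nonneg _).trans hx)
    _ = _ := by ring

/-- Solution of the quadratic likelihood equation `A + (B - I) d + (J + C) d² / 2 ≈ 0` up to
third order, where `A`, `B`, `C` are of order `u`. -/
theorem exists_root_expansion {I : ℝ} (hI : 0 < I) (J : ℝ) {K : ℝ} (hK : 0 ≤ K) :
    ∃ κ : ℝ, 0 ≤ κ ∧ ∀ A B C d u : ℝ, |A| ≤ u → |B| ≤ u → |C| ≤ u →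
      |B| ≤ I / 4 → K * |d| ≤ I / 4 →
      |A + (B - I) * d| ≤ K * |d| ^ 2 →
      |A + (B - I) * d + (J + C) / 2 * d ^ 2| ≤ K * |d| ^ 3 →
      |d| ≤ κ * u ^ 1 ∧ |d - A / I| ≤ κ * u ^ 2 ∧
        |d - A / I - (A * B / I ^ 2 + J * A ^ 2 / (2 * I ^ 3))| ≤ κ * u ^ 3 := by
  set k1 : ℝ := 2 / I with hk1
  set k2 : ℝ := (k1 + K * k1 ^ 2) / I with hk2
  set k3 : ℝ := (k1 * k1 / 2 + K * k1 ^ 3 + k2 + |J| / 2 * (k2 * (k1 + 1 / I))) / I with hk3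
  have p1 : 0 < k1 := by positivity
  have p2 : 0 ≤ k2 := by positivity
  have p3 : 0 ≤ k3 := by positivity
  refine ⟨k1 + k2 + k3, by positivity, fun A B C d u hA hB hC hB' hd h1 h2 => ?_⟩
  have hu : 0 ≤ u := (abs_nonneg A).trans hA
  have d1 : |d| ≤ k1 * u ^ 1 := by
    have t1 : I * |d| ≤ |A| + |B| * |d| + |A + (B - I) * d| := by
      rw [← abs_of_pos hI, ← abs_mul, abs_of_pos hI, ← abs_mul]
      have : I * d = A + B * d - (A + (B - I) * d) := by ring
      calc |I * d| = |A + B * d - (A + (B - I) * d)| := by rw [← this]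
        _ ≤ |A + B * d| + |A + (B - I) * d| := abs_sub _ _
        _ ≤ _ := by gcongr; exact abs_add_le _ _
    have t2 : |B| * |d| ≤ I / 4 * |d| := mul_le_mul_of_nonneg_right hB' (abs_nonneg _)
    have t3 : K * |d| ^ 2 ≤ I / 4 * |d| := by
      rw [sq, ← mul_assoc]; exact mul_le_mul_of_nonneg_right hd (abs_nonneg _)
    rw [hk1, pow_one, div_mul_eq_mul_div, le_div_iff₀ hI]
    linarith
  have hu1 : ∀ {y}, |y| ≤ u → |y| ≤ 1 * u ^ 1 := fun h => by simpa using h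
  have hdp : ∀ j : ℕ, |d| ^ j ≤ k1 ^ j * u ^ j := fun j => by
    rw [← mul_pow]; exact pow_le_pow_left₀ (abs_nonneg _) (by simpa using d1) j
  have d2 : |d - A / I| ≤ k2 * u ^ 2 := by
    have e : d - A / I = (B * d - (A + (B - I) * d)) / I := by field_simp; ring
    rw [e, abs_div, abs_of_pos hI, hk2, div_mul_eq_mul_div]
    refine div_le_div_of_nonneg_right ?_ hI.le
    have t1 := abs_mul_le_mul_pow (hu1 hB) d1 (k := 2) rfl
    have t2 := mul_le_mul_of_nonneg_left (hdp 2) hK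
    have t3 := abs_sub (B * d) (A + (B - I) * d)
    linarith
  have d3 : |d - A / I - (A * B / I ^ 2 + J * A ^ 2 / (2 * I ^ 3))| ≤ k3 * u ^ 3 := by
    have e : d - A / I - (A * B / I ^ 2 + J * A ^ 2 / (2 * I ^ 3))
        = (C * (d * d) / 2 - (A + (B - I) * d + (J + C) / 2 * d ^ 2)
          + B * (d - A / I) + J / 2 * ((d - A / I) * (d + A / I))) / I := by
      field_simp; ring
    rw [e, abs_div, abs_of_pos hI, hk3, div_mul_eq_mul_div _ I _]
    refine div_le_div_of_nonneg_right ?_ hI.le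
    have t1 := abs_mul_le_mul_pow (hu1 hC) (abs_mul_le_mul_pow d1 d1 (k := 2) rfl) (k := 3) rfl
    have t2 := mul_le_mul_of_nonneg_left (hdp 3) hK
    have t3 := abs_mul_le_mul_pow (hu1 hB) d2 (k := 3) rfl
    have t4 : |d + A / I| ≤ (k1 + 1 / I) * u ^ 1 := by
      refine (abs_add_le _ _).trans ?_
      rw [add_mul]
      refine add_le_add d1 ?_
      rw [abs_div, abs_of_pos hI, pow_one, div_mul_eq_mul_div, one_mul]
      exact div_le_div_of_nonneg_right hA hI.le
    have t5 := abs_mul_le_mul_pow d2 t4 (k := 3) rfl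
    have t6 : |J / 2 * ((d - A / I) * (d + A / I))|
        ≤ |J| / 2 * (k2 * (k1 + 1 / I) * u ^ 3) := by
      rw [abs_mul, abs_div, abs_two]
      exact mul_le_mul_of_nonneg_left t5 (by positivity)
    have t7 : |C * (d * d) / 2| = |C * (d * d)| / 2 := by rw [abs_div, abs_two]
    have t8 := abs_add_le (C * (d * d) / 2 - (A + (B - I) * d + (J + C) / 2 * d ^ 2)
          + B * (d - A / I)) (J / 2 * ((d - A / I) * (d + A / I)))
    have t9 := abs_add_le (C * (d * d) / 2 - (A + (B - I) * d + (J + C) / 2 * d ^ 2))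
          (B * (d - A / I))
    have t10 := abs_sub (C * (d * d) / 2) (A + (B - I) * d + (J + C) / 2 * d ^ 2)
    linarith
  have q : ∀ j : ℕ, 0 ≤ u ^ j := fun j => pow_nonneg hu j
  refine ⟨d1.trans ?_, d2.trans ?_, d3.trans ?_⟩
  · exact mul_le_mul_of_nonneg_right (by linarith) (q 1)
  · exact mul_le_mul_of_nonneg_right (by linarith) (q 2)
  · exact mul_le_mul_of_nonneg_right (by linarith) (q 3)

/-- Truncation to `[a, b]` does not move a point beyond `θ₀`, and does not move points near
`θ₀` at all. -/
theorem truncation_bounds {a b θ₀ ρ w : ℝ} (ha : a + ρ ≤ θ₀) (hb : θ₀ + ρ ≤ b) (hρ : 0 ≤ ρ) :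
    |max a (min b (θ₀ + w)) - θ₀| ≤ |w| ∧ |max a (min b (θ₀ + w)) - θ₀ - w| ≤ |w| ∧
      (|w| ≤ ρ → max a (min b (θ₀ + w)) - θ₀ = w) := by
  have hab : a ≤ b := by linarith
  rcases le_total b (θ₀ + w) with h | h
  · rw [min_eq_left h, max_eq_right hab]
    have hw : 0 ≤ w := by linarith
    rw [abs_of_nonneg hw]
    refine ⟨?_, ?_, fun h' => by linarith⟩ <;> rw [abs_le] <;> constructor <;> linarith
  · rw [min_eq_right h]
    rcases le_total a (θ₀ + w) with h' | h'
    · rw [max_eq_right h']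
      refine ⟨by simp, by simp, fun _ => by ring⟩
    · rw [max_eq_left h']
      have hw : w ≤ 0 := by linarith
      rw [abs_of_nonpos hw]
      refine ⟨?_, ?_, fun h' => by linarith⟩ <;> rw [abs_le] <;> constructor <;> linarith

/-- Expansion of the truncated, bias-corrected root; here `h²` stands for `1 / n`, and `β` for the
bias coefficient at the root. -/
theorem exists_corrected_expansion {I : ℝ} (hI : 0 < I) {κ β₀ L ρ : ℝ} (hκ : 0 ≤ κ)
    (hL : 0 ≤ L) (hρ : 0 < ρ) :
    ∃ κ' : ℝ, 0 ≤ κ' ∧ ∀ A Q d β h u Z : ℝ, 0 ≤ h → h ≤ 1 → h ≤ u → |A| ≤ u → |d| ≤ 1 →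
      |d| ≤ κ * u ^ 1 → |d - A / I| ≤ κ * u ^ 2 → |d - A / I - Q| ≤ κ * u ^ 3 →
      |β - β₀| ≤ L * |d| → |Z| ≤ |d - β * h ^ 2| → |Z - (d - β * h ^ 2)| ≤ |d - β * h ^ 2| →
      (|d - β * h ^ 2| ≤ ρ → Z = d - β * h ^ 2) →
      |Z - A / I - Q + β₀ * h ^ 2| ≤ κ' * u ^ 3 ∧ |Z ^ 2 - (A / I) ^ 2| ≤ κ' * u ^ 3 := by
  set k1 : ℝ := κ + (|β₀| + L) with hk1
  have p1 : 0 ≤ k1 := by positivity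
  set k2 : ℝ := k1 * k1 / ρ + (|β₀| + L) + κ with hk2
  set k3 : ℝ := k1 * k1 * k1 / ρ ^ 2 + L * κ + κ with hk3
  have p2 : 0 ≤ k2 := by positivity
  have p3 : 0 ≤ k3 := by positivity
  refine ⟨k3 + k2 * (k1 + 1 / I), by positivity, ?_⟩
  intro A Q d β h u Z h0 h1 hu hA hd d1 d2 d3 hβ hZ hZw hZe
  have u0 : 0 ≤ u := h0.trans hu
  set w := d - β * h ^ 2 with hw
  have hh2 : h ^ 2 ≤ u ^ 2 := pow_le_pow_left₀ h0 hu 2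
  have hh1 : h ^ 2 ≤ u := by nlinarith
  have hβ1 : |β| ≤ |β₀| + L := by
    have := abs_sub_abs_le_abs_sub β β₀
    nlinarith
  have hβ2 : |β * h ^ 2| ≤ (|β₀| + L) * u ^ 2 := by
    rw [abs_mul, abs_of_nonneg (sq_nonneg h)]
    exact mul_le_mul hβ1 hh2 (sq_nonneg _) (by positivity)
  have w1 : |w| ≤ k1 * u ^ 1 := by
    have t : |β * h ^ 2| ≤ (|β₀| + L) * u := by
      rw [abs_mul, abs_of_nonneg (sq_nonneg h)]
      exact mul_le_mul hβ1 hh1 (sq_nonneg _) (by positivity)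
    have := abs_sub d (β * h ^ 2)
    rw [hk1, add_mul]
    linarith [pow_one u]
  have w2 := abs_mul_le_mul_pow w1 w1 (k := 2) rfl
  have w3 := abs_mul_le_mul_pow w2 w1 (k := 3) rfl
  have z2 : |Z - w| ≤ k1 * k1 / ρ * u ^ 2 := by
    rcases le_or_gt |w| ρ with hc | hc
    · rw [hZe hc, sub_self, abs_zero]; positivity
    · rw [div_mul_eq_mul_div, le_div_iff₀ hρ]
      refine le_trans ?_ w2
      rw [abs_mul]
      exact mul_le_mul hZw hc.le hρ.le (abs_nonneg _)
  have z3 : |Z - w| ≤ k1 * k1 * k1 / ρ ^ 2 * u ^ 3 := by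
    rcases le_or_gt |w| ρ with hc | hc
    · rw [hZe hc, sub_self, abs_zero]; positivity
    · rw [div_mul_eq_mul_div, le_div_iff₀ (by positivity)]
      refine le_trans ?_ w3
      rw [abs_mul, abs_mul, sq, ← mul_assoc]
      exact mul_le_mul (mul_le_mul hZw hc.le hρ.le (abs_nonneg _)) hc.le hρ.le (by positivity)
  have q3 : 0 ≤ u ^ 3 := pow_nonneg u0 3
  constructor
  · have e : Z - A / I - Q + β₀ * h ^ 2 = (Z - w) + (d - A / I - Q) - (β - β₀) * h ^ 2 := by
      rw [hw]; ring
    have t1 : |(β - β₀) * h ^ 2| ≤ L * κ * u ^ 3 := by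
      refine abs_mul_le_mul_pow (i := 1) (j := 2) (p := L * κ) (q := 1) ?_ ?_ rfl |>.trans
        (by rw [mul_one])
      · rw [mul_assoc]; exact hβ.trans (mul_le_mul_of_nonneg_left d1 hL)
      · rw [abs_of_nonneg (sq_nonneg h), one_mul]; exact hh2
    have t2 := abs_sub ((Z - w) + (d - A / I - Q)) ((β - β₀) * h ^ 2)
    have t3 := abs_add_le (Z - w) (d - A / I - Q)
    have t4 : 0 ≤ k2 * (k1 + 1 / I) * u ^ 3 := by positivity
    rw [e, add_mul]
    have : k3 * u ^ 3 = k1 * k1 * k1 / ρ ^ 2 * u ^ 3 + L * κ * u ^ 3 + κ * u ^ 3 := by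
      rw [hk3]; ring
    linarith
  · have e : Z ^ 2 - (A / I) ^ 2 = (Z - A / I) * (Z + A / I) := by ring
    have t1 : |Z - A / I| ≤ k2 * u ^ 2 := by
      have e : Z - A / I = (Z - w) - β * h ^ 2 + (d - A / I) := by rw [hw]; ring
      have t2 := abs_add_le ((Z - w) - β * h ^ 2) (d - A / I)
      have t3 := abs_sub (Z - w) (β * h ^ 2)
      rw [e, hk2, add_mul, add_mul]
      linarith
    have t2 : |Z + A / I| ≤ (k1 + 1 / I) * u ^ 1 := by
      refine (abs_add_le _ _).trans ?_
      rw [add_mul]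
      refine add_le_add (hZ.trans w1) ?_
      rw [abs_div, abs_of_pos hI, pow_one, div_mul_eq_mul_div, one_mul]
      exact div_le_div_of_nonneg_right hA hI.le
    have t3 := abs_mul_le_mul_pow t1 t2 (k := 3) rfl
    have t4 : 0 ≤ k3 * u ^ 3 := by positivity
    rw [e, add_mul]
    linarith

section Expansion

variable {D : Type*} [MeasurableSpace D] {μ : Measure D} {f : D → ℝ → ℝ} {a b : ℝ} {M : D → ℝ}

theorem abs_empMean_le {D : Type*} {n : ℕ} {p q : D → ℝ} {x : Fin n → D}
    (h : ∀ y, |p y| ≤ q y) : |empMean n p x| ≤ empMean n q x := by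
  simp only [empMean]
  rw [abs_div, abs_of_nonneg (Nat.cast_nonneg (α := ℝ) n)]
  exact div_le_div_of_nonneg_right ((Finset.abs_sum_le_sum_abs _ _).trans
    (Finset.sum_le_sum fun i _ => h _)) (Nat.cast_nonneg _)

/-- An MLE in the interior of the parameter space solves the likelihood equation. -/
theorem IsMLE.sum_score_eq_zero {mle : ∀ n : ℕ, (Fin n → D) → ℝ} (hmle : IsMLE f a b mle)
    (hreg : RegularModel μ f a b) {n : ℕ} {x : Fin n → D} {θ₀ : ℝ} (hθ₀ : θ₀ ∈ Icc a b)
    (hx : ∀ i, 0 < f (x i) θ₀) (hin : mle n x ∈ Ioo a b) :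
    ∑ i, logDeriv f 1 (x i) (mle n x) = 0 := by
  have hd : HasDerivAt (fun θ => ∑ i, logDeriv f 0 (x i) θ)
      (∑ i, logDeriv f (0 + 1) (x i) (mle n x)) (mle n x) :=
    HasDerivAt.fun_sum fun i _ => hasDerivAt_logDeriv hreg hin (by norm_num) (x i)
  refine IsLocalMax.hasDerivAt_eq_zero ?_ hd
  filter_upwards [isOpen_Ioo.mem_nhds hin] with θ hθ
  simp_rw [logDeriv_zero]
  exact hmle.sum_log_le hreg hθ₀ (Ioo_subset_Icc_self hθ) hx

/-- The centered second derivative of the log-density. -/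
def centeredHessian (μ : Measure D) (f : D → ℝ → ℝ) (θ : ℝ) (y : D) : ℝ :=
  logDeriv f 2 y θ + fisherInfo μ f θ

/-- The centered third derivative of the log-density. -/
def centeredThird (μ : Measure D) (f : D → ℝ → ℝ) (θ : ℝ) (y : D) : ℝ :=
  logDeriv f 3 y θ - ∫ z, logDeriv f 3 z θ ∂(law μ f θ)

/-- The quadratic part of the expansion of the MLE, in terms of the empirical means `A` and `B` of
the score and of the centered second derivative. -/
def quadraticPart (μ : Measure D) (f : D → ℝ → ℝ) (θ : ℝ) (A B : ℝ) : ℝ :=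
  A * B / fisherInfo μ f θ ^ 2
    + (∫ z, logDeriv f 3 z θ ∂(law μ f θ)) * A ^ 2 / (2 * fisherInfo μ f θ ^ 3)

/-- The random scale, of order `n^{-1/2}`, in which the remainders of the expansions are
measured. -/
def scale (μ : Measure D) (f : D → ℝ → ℝ) (θ : ℝ) (n : ℕ) (x : Fin n → D) : ℝ :=
  |empMean n (fun y => logDeriv f 1 y θ) x| + |empMean n (centeredHessian μ f θ) x|
    + |empMean n (centeredThird μ f θ) x| + 1 / √n

theorem integral_centeredHessian (hreg : RegularModel μ f a b) {θ : ℝ} (hθ : θ ∈ Ioo a b) :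
    ∫ y, centeredHessian μ f θ y ∂(law μ f θ) = 0 := by
  obtain ⟨M, hM⟩ := hreg.exists_isEnvelope
  have := hreg.prob θ (Ioo_subset_Icc_self hθ)
  simp only [centeredHessian]
  rw [integral_add ((hM.memLp_logDeriv hreg hθ (j := 2) (by norm_num) (by norm_num)).integrable
    (by norm_num)) (integrable_const _), integral_logDeriv_two hreg hθ]
  simp

theorem integral_centeredThird (hreg : RegularModel μ f a b) {θ : ℝ} (hθ : θ ∈ Ioo a b) :
    ∫ y, centeredThird μ f θ y ∂(law μ f θ) = 0 := by
  obtain ⟨M, hM⟩ := hreg.exists_isEnvelope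
  have := hreg.prob θ (Ioo_subset_Icc_self hθ)
  simp only [centeredThird]
  rw [integral_sub ((hM.memLp_logDeriv hreg hθ (j := 3) (by norm_num) (by norm_num)).integrable
    (by norm_num)) (integrable_const _)]
  simp

theorem memLp_score (hreg : RegularModel μ f a b) {θ : ℝ} (hθ : θ ∈ Ioo a b) :
    MemLp (fun y => logDeriv f 1 y θ) 4 (law μ f θ) := by
  obtain ⟨M, hM⟩ := hreg.exists_isEnvelope
  exact hM.memLp_logDeriv hreg hθ (by norm_num) (by norm_num)

theorem memLp_centeredHessian (hreg : RegularModel μ f a b) {θ : ℝ} (hθ : θ ∈ Ioo a b) :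
    MemLp (centeredHessian μ f θ) 4 (law μ f θ) := by
  obtain ⟨M, hM⟩ := hreg.exists_isEnvelope
  have := hreg.prob θ (Ioo_subset_Icc_self hθ)
  exact (hM.memLp_logDeriv hreg hθ (j := 2) (by norm_num) (by norm_num)).add (memLp_const _)

theorem memLp_centeredThird (hreg : RegularModel μ f a b) {θ : ℝ} (hθ : θ ∈ Ioo a b) :
    MemLp (centeredThird μ f θ) 4 (law μ f θ) := by
  obtain ⟨M, hM⟩ := hreg.exists_isEnvelope
  have := hreg.prob θ (Ioo_subset_Icc_self hθ)
  exact (hM.memLp_logDeriv hreg hθ (j := 3) (by norm_num) (by norm_num)).sub (memLp_const _)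

theorem measurable_centeredHessian (hreg : RegularModel μ f a b) {θ : ℝ} (hθ : θ ∈ Ioo a b) :
    Measurable (centeredHessian μ f θ) :=
  (measurable_logDeriv hreg (by norm_num) hθ).add_const _

theorem measurable_centeredThird (hreg : RegularModel μ f a b) {θ : ℝ} (hθ : θ ∈ Ioo a b) :
    Measurable (centeredThird μ f θ) :=
  (measurable_logDeriv hreg (by norm_num) hθ).sub_const _

/-- The expansions of the MLE, of the bias-corrected MLE and of its square hold with third-order
remainders outside an event of probability `O(n⁻²)`. -/
theorem IsMLE.exists_expansion_event {mle : ∀ n : ℕ, (Fin n → D) → ℝ}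
    (hmle : IsMLE f a b mle) (hreg : RegularModel μ f a b) {θ₀ : ℝ} (hθ₀ : θ₀ ∈ Ioo a b) :
    ∃ κ : ℝ, 0 ≤ κ ∧ ∃ C : ℝ, ∃ E : ∀ n : ℕ, Set (Fin n → D), (∀ n, MeasurableSet (E n)) ∧
      (∀ n, 1 ≤ n → (sampleLaw μ f n θ₀).real (E n) ≤ C / (n : ℝ) ^ 2) ∧
      ∀ n, 1 ≤ n → ∀ x : Fin n → D, (∀ i, 0 < f (x i) θ₀) → x ∉ E n → ∀ A B : ℝ,
        A = empMean n (fun y => logDeriv f 1 y θ₀) x →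
        B = empMean n (centeredHessian μ f θ₀) x →
        |mle n x - θ₀ - A / fisherInfo μ f θ₀ - quadraticPart μ f θ₀ A B|
            ≤ κ * scale μ f θ₀ n x ^ 3 ∧
        |bcMLE μ f a b mle n x - θ₀ - A / fisherInfo μ f θ₀ - quadraticPart μ f θ₀ A B
            + biasCoeff μ f θ₀ / n| ≤ κ * scale μ f θ₀ n x ^ 3 ∧
        |(bcMLE μ f a b mle n x - θ₀) ^ 2 - (A / fisherInfo μ f θ₀) ^ 2|
            ≤ κ * scale μ f θ₀ n x ^ 3 := by
  obtain ⟨M, hM⟩ := hreg.exists_isEnvelope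
  have hθ₀' := Ioo_subset_Icc_self hθ₀
  have hP := hreg.prob θ₀ hθ₀'
  have hPn := isProbabilityMeasure_sampleLaw hreg hθ₀'
  have hI := hreg.fisher_pos θ₀ hθ₀
  set I := fisherInfo μ f θ₀ with hIdef
  set J := ∫ z, logDeriv f 3 z θ₀ ∂(law μ f θ₀) with hJdef
  set m : ℝ := ∫ x, M x ∂(law μ f θ₀) with hm
  have hm0 : 0 ≤ m := integral_nonneg hM.nonneg
  obtain ⟨δ₁, hδ₁, L, hL, hbias⟩ := exists_abs_biasCoeff_sub_le hreg hθ₀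
  obtain ⟨κ₁, hκ₁, hroot⟩ := exists_root_expansion hI J (K := m + 1) (by linarith)
  set ρ : ℝ := min (θ₀ - a) (b - θ₀) with hρ
  have hρ0 : 0 < ρ := lt_min (sub_pos.2 hθ₀.1) (sub_pos.2 hθ₀.2)
  have hρa : a + ρ ≤ θ₀ := by linarith [min_le_left (θ₀ - a) (b - θ₀)]
  have hρb : θ₀ + ρ ≤ b := by linarith [min_le_right (θ₀ - a) (b - θ₀)]
  obtain ⟨κ₂, hκ₂, hcorr⟩ := exists_corrected_expansion hI (β₀ := biasCoeff μ f θ₀) hκ₁ hL hρ0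
  set δ : ℝ := min (min δ₁ 1) (min ρ (I / (4 * (m + 1)))) with hδ
  have hδ0 : 0 < δ := by
    refine lt_min (lt_min hδ₁ one_pos) (lt_min hρ0 (by positivity))
  obtain ⟨C₁, hC₁⟩ := hmle.exists_measureReal_abs_sub_ge_le hreg hθ₀ hδ0
  obtain ⟨C₂, hC₂⟩ := exists_measureReal_abs_empMean_sub_ge_le hM.meas
    (hM.memLp hreg hθ₀) one_pos
  obtain ⟨C₃, hC₃⟩ := exists_measureReal_abs_empMean_sub_ge_le
    (measurable_centeredHessian hreg hθ₀) (memLp_centeredHessian hreg hθ₀)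
    (c := I / 4) (by positivity)
  rw [integral_centeredHessian hreg hθ₀] at hC₃
  refine ⟨κ₁ + κ₂, by positivity, C₁ + C₂ + C₃, fun n => {x | δ ≤ |mle n x - θ₀|}
    ∪ {x | 1 ≤ |empMean n M x - m|} ∪ {x | I / 4 ≤ |empMean n (centeredHessian μ f θ₀) x - 0|},
    fun n => ?_, fun n hn => ?_, ?_⟩
  · have m1 := (hmle n).1
    have m2 : Measurable (empMean n M) := measurable_empMean hM.meas
    have m3 : Measurable (empMean n (centeredHessian μ f θ₀)) :=
      measurable_empMean (measurable_centeredHessian hreg hθ₀)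
    refine ((measurableSet_le measurable_const ?_).union
      (measurableSet_le measurable_const ?_)).union (measurableSet_le measurable_const ?_)
    · exact (m1.sub_const _).abs
    · exact (m2.sub_const _).abs
    · exact (m3.sub_const _).abs
  · rw [add_div, add_div]
    refine (measureReal_union_le _ _).trans (add_le_add ((measureReal_union_le _ _).trans
      (add_le_add (hC₁ n hn) (hC₂ n hn))) (hC₃ n hn))
  intro n hn x hx hxE A B hA hB
  simp only [mem_union, mem_ofPred_eq, not_or, not_le, sub_zero] at hxE
  obtain ⟨⟨hd, hMx⟩, hBx⟩ := hxE
  have hn' : (0 : ℝ) < n := by exact_mod_cast hn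
  set θ := mle n x with hθdef
  set d := θ - θ₀ with hddef
  have hdδ₁ : |d| < δ₁ := hd.trans_le ((min_le_left _ _).trans (min_le_left _ _))
  have hd1 : |d| < 1 := hd.trans_le ((min_le_left _ _).trans (min_le_right _ _))
  have hdρ : |d| < ρ := hd.trans_le ((min_le_right _ _).trans (min_le_left _ _))
  have hdI : |d| < I / (4 * (m + 1)) :=
    hd.trans_le ((min_le_right _ _).trans (min_le_right _ _))
  have hin : θ ∈ Ioo a b := by
    rw [abs_lt] at hdρ
    constructor <;> linarith [hdρ.1, hdρ.2]
  have hscore := hmle.sum_score_eq_zero hreg hθ₀' hx hin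
  rw [← hθdef] at hscore
  set Cc := empMean n (centeredThird μ f θ₀) x with hCc
  set u := scale μ f θ₀ n x with hu
  have hudef : u = |A| + |B| + |Cc| + 1 / √n := by rw [hu, scale, hA, hB]
  have hs0 : (0 : ℝ) ≤ 1 / √n := by positivity
  have uA : |A| ≤ u := by rw [hudef]; linarith [abs_nonneg B, abs_nonneg Cc]
  have uB : |B| ≤ u := by rw [hudef]; linarith [abs_nonneg A, abs_nonneg Cc]
  have uC : |Cc| ≤ u := by rw [hudef]; linarith [abs_nonneg A, abs_nonneg B]
  have uh : 1 / √n ≤ u := by rw [hudef]; linarith [abs_nonneg A, abs_nonneg B, abs_nonneg Cc]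
  have hMm : empMean n M x ≤ m + 1 := by linarith [(abs_lt.1 hMx).2]
  have hKd : (m + 1) * |d| ≤ I / 4 := by
    have := (lt_div_iff₀ (by positivity : 0 < 4 * (m + 1))).1 hdI
    linarith
  have t1 : |A + (B - I) * d| ≤ (m + 1) * |d| ^ 2 := by
    have e : empMean n (fun y => logDeriv f 1 y θ - logDeriv f 1 y θ₀ - logDeriv f 2 y θ₀ * d) x
        = -(A + (B - I) * d) := by
      rw [hA, hB]
      simp only [empMean, centeredHessian, Finset.sum_sub_distrib, Finset.sum_add_distrib,
        ← Finset.sum_mul, hscore]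
      simp
      field_simp
      ring
    rw [← abs_neg, ← e]
    refine (abs_empMean_le fun y => hM.taylor_one hreg hθ₀ hin y).trans ?_
    rw [empMean, ← Finset.sum_mul, mul_div_right_comm]
    exact mul_le_mul_of_nonneg_right hMm (by positivity)
  have t2 : |A + (B - I) * d + (J + Cc) / 2 * d ^ 2| ≤ (m + 1) * |d| ^ 3 := by
    have e : empMean n (fun y => logDeriv f 1 y θ - logDeriv f 1 y θ₀ - logDeriv f 2 y θ₀ * d
        - logDeriv f 3 y θ₀ / 2 * d ^ 2) x
        = -(A + (B - I) * d + (J + Cc) / 2 * d ^ 2) := by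
      rw [hA, hB, hCc]
      simp only [empMean, centeredHessian, centeredThird, Finset.sum_sub_distrib,
        Finset.sum_add_distrib, ← Finset.sum_mul, ← Finset.sum_div, hscore]
      simp
      field_simp
      ring
    rw [← abs_neg, ← e]
    refine (abs_empMean_le fun y => hM.taylor_two hreg hθ₀ hin y).trans ?_
    rw [empMean, ← Finset.sum_mul, mul_div_right_comm]
    exact mul_le_mul_of_nonneg_right hMm (by positivity)
  obtain ⟨r1, r2, r3⟩ := hroot A B Cc d u uA uB uC (by rw [hB]; exact hBx.le) hKd t1 t2
  have hsq : (1 / √(n : ℝ)) ^ 2 = 1 / n := by rw [div_pow, Real.sq_sqrt hn'.le, one_pow]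
  have hZ : bcMLE μ f a b mle n x
      = max a (min b (θ₀ + (d - biasCoeff μ f θ * (1 / √(n : ℝ)) ^ 2))) := by
    rw [bcMLE, ← hθdef, indicator_of_mem hin, hsq]
    congr 2
    rw [hddef]; ring
  obtain ⟨z1, z2, z3⟩ := truncation_bounds (w := d - biasCoeff μ f θ * (1 / √(n : ℝ)) ^ 2)
    hρa hρb hρ0.le
  rw [← hZ] at z1 z2 z3
  obtain ⟨c1, c2⟩ := hcorr A (quadraticPart μ f θ₀ A B) d (biasCoeff μ f θ) (1 / √(n : ℝ)) u
    (bcMLE μ f a b mle n x - θ₀) hs0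
    (by rw [div_le_one (by positivity)]; exact Real.one_le_sqrt.2 (by exact_mod_cast hn))
    uh uA hd1.le r1 r2 r3 (hbias θ hdδ₁) z1 z2 z3
  rw [hsq, mul_one_div] at c1
  have hu3 : 0 ≤ u ^ 3 := pow_nonneg (hs0.trans uh) 3
  have g1 : κ₁ * u ^ 3 ≤ (κ₁ + κ₂) * u ^ 3 := mul_le_mul_of_nonneg_right (by linarith) hu3
  have g2 : κ₂ * u ^ 3 ≤ (κ₁ + κ₂) * u ^ 3 := mul_le_mul_of_nonneg_right (by linarith) hu3
  exact ⟨r3.trans g1, c1.trans g2, c2.trans g2⟩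

/-- Remainders of third order outside a rare event, and bounded by a polynomial of degree four on
it, are `O(n^{-3/2})` in mean. -/
theorem exists_integral_remainder_le (hreg : RegularModel μ f a b) {θ₀ : ℝ}
    (hθ₀ : θ₀ ∈ Ioo a b) (κ : ℝ) (hκ : 0 ≤ κ) (C : ℝ) :
    ∃ C' : ℝ, ∀ n : ℕ, 1 ≤ n → ∀ E : Set (Fin n → D), MeasurableSet E →
      (sampleLaw μ f n θ₀).real E ≤ C / (n : ℝ) ^ 2 → ∀ X : (Fin n → D) → ℝ,
      (∀ᵐ x ∂(sampleLaw μ f n θ₀), |X x| ≤ κ * (scale μ f θ₀ n x ^ 3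
        + scale μ f θ₀ n x ^ 4 + E.indicator (fun _ => 1) x)) →
      |∫ x, X x ∂(sampleLaw μ f n θ₀)| ≤ C' * (1 / √n) ^ 3 := by
  have hθ₀' := Ioo_subset_Icc_self hθ₀
  have hP := hreg.prob θ₀ hθ₀'
  have hPn := isProbabilityMeasure_sampleLaw hreg hθ₀'
  set Y₁ : D → ℝ := fun y => logDeriv f 1 y θ₀
  have mY₁ : Measurable Y₁ := measurable_logDeriv hreg (by norm_num) hθ₀
  have mY₂ := measurable_centeredHessian hreg hθ₀
  have mY₃ := measurable_centeredThird hreg hθ₀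
  have L₁ : MemLp Y₁ 4 (law μ f θ₀) := memLp_score hreg hθ₀
  have L₂ := memLp_centeredHessian hreg hθ₀
  have L₃ := memLp_centeredThird hreg hθ₀
  set c₁ := 3 * ∫ y, Y₁ y ^ 4 ∂(law μ f θ₀)
  set c₂ := 3 * ∫ y, centeredHessian μ f θ₀ y ^ 4 ∂(law μ f θ₀)
  set c₃ := 3 * ∫ y, centeredThird μ f θ₀ y ^ 4 ∂(law μ f θ₀)
  refine ⟨κ * (1 + 2 * (64 * (c₁ + c₂ + c₃ + 1)) + |C|), ?_⟩
  intro n hn E hE hEC X hX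
  have hn0 : n ≠ 0 := by omega
  have hn' : (0 : ℝ) < n := by exact_mod_cast hn
  set h : ℝ := 1 / √n with hh
  have hpos : 0 < h := by positivity
  have hle : h ≤ 1 := by
    rw [hh, div_le_one (by positivity)]; exact Real.one_le_sqrt.2 (by exact_mod_cast hn)
  have hsq : h ^ 2 = 1 / n := by rw [hh, div_pow, Real.sq_sqrt hn'.le, one_pow]
  have hfour : h ^ 4 = 1 / (n : ℝ) ^ 2 := by
    rw [show h ^ 4 = (h ^ 2) ^ 2 by ring, hsq, div_pow, one_pow]
  set W : (Fin n → D) → ℝ := fun x => empMean n Y₁ x ^ 4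
    + empMean n (centeredHessian μ f θ₀) x ^ 4 + empMean n (centeredThird μ f θ₀) x ^ 4 with hW
  have i₁ : Integrable (fun x => empMean n Y₁ x ^ 4) (sampleLaw μ f n θ₀) :=
    integrable_pow_of_memLp_four (memLp_empMean L₁) le_rfl
  have i₂ : Integrable (fun x => empMean n (centeredHessian μ f θ₀) x ^ 4)
    (sampleLaw μ f n θ₀) := integrable_pow_of_memLp_four (memLp_empMean L₂) le_rfl
  have i₃ : Integrable (fun x => empMean n (centeredThird μ f θ₀) x ^ 4)
    (sampleLaw μ f n θ₀) := integrable_pow_of_memLp_four (memLp_empMean L₃) le_rfl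
  have iW : Integrable W (sampleLaw μ f n θ₀) := (i₁.add i₂).add i₃
  have vW : ∫ x, W x ∂(sampleLaw μ f n θ₀) ≤ (c₁ + c₂ + c₃) * h ^ 4 := by
    have v₁ : _ ≤ c₁ / (n : ℝ) ^ 2 :=
      integral_empMean_pow_four_le hn0 mY₁ L₁ (integral_score_eq_zero hreg hθ₀)
    have v₂ : _ ≤ c₂ / (n : ℝ) ^ 2 :=
      integral_empMean_pow_four_le hn0 mY₂ L₂ (integral_centeredHessian hreg hθ₀)
    have v₃ : _ ≤ c₃ / (n : ℝ) ^ 2 :=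
      integral_empMean_pow_four_le hn0 mY₃ L₃ (integral_centeredThird hreg hθ₀)
    simp only [hW]
    rw [integral_add (i₁.fun_add i₂) i₃, integral_add i₁ i₂, hfour, mul_one_div, add_div, add_div]
    exact add_le_add (add_le_add v₁ v₂) v₃
  have hbound : ∀ᵐ x ∂(sampleLaw μ f n θ₀), |X x|
      ≤ κ * (h ^ 3 + 128 / h * (W x + h ^ 4) + E.indicator (fun _ => 1) x) := by
    filter_upwards [hX] with x hx
    refine hx.trans (mul_le_mul_of_nonneg_left ?_ hκ)
    gcongr ?_ + _
    set u := scale μ f θ₀ n x with hu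
    have hu0 : 0 ≤ u := by rw [hu, scale]; positivity
    have u4 : u ^ 4 ≤ 64 * (W x + h ^ 4) := by
      have add4 : ∀ p q : ℝ, 0 ≤ p → 0 ≤ q → (p + q) ^ 4 ≤ 8 * (p ^ 4 + q ^ 4) :=
        fun p q hp hq => (add_pow_le hp hq 4).trans_eq (by norm_num)
      set A := empMean n Y₁ x
      set B := empMean n (centeredHessian μ f θ₀) x
      set Cc := empMean n (centeredThird μ f θ₀) x
      have e : u = (|A| + |B|) + (|Cc| + h) := by rw [hu, scale]; ring
      have k1 := add4 (|A| + |B|) (|Cc| + h) (by positivity) (by positivity)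
      have k2 := add4 |A| |B| (abs_nonneg _) (abs_nonneg _)
      have k3 := add4 |Cc| h (abs_nonneg _) hpos.le
      rw [Even.pow_abs (by decide : Even 4), Even.pow_abs (by decide : Even 4)] at k2
      rw [Even.pow_abs (by decide : Even 4)] at k3
      rw [e]
      simp only [hW]
      linarith
    -- `v³ ≤ 1 + v⁴` at `v = u / h`
    have u3 : u ^ 3 ≤ h ^ 3 + u ^ 4 / h := by
      rw [← sub_le_iff_le_add', le_div_iff₀ hpos]
      rcases le_total u h with hc | hc
      · have : u ^ 3 ≤ h ^ 3 := pow_le_pow_left₀ hu0 hc 3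
        nlinarith [pow_nonneg hu0 4]
      · have : u ^ 3 * h ≤ u ^ 3 * u := mul_le_mul_of_nonneg_left hc (pow_nonneg hu0 3)
        nlinarith [pow_pos hpos 4]
    have u4' : u ^ 4 ≤ u ^ 4 / h := by
      rw [le_div_iff₀ hpos]
      exact mul_le_of_le_one_right (pow_nonneg hu0 4) hle
    have u5 : u ^ 4 / h ≤ 64 * (W x + h ^ 4) / h := div_le_div_of_nonneg_right u4 hpos.le
    have e : 128 / h * (W x + h ^ 4) = 2 * (64 * (W x + h ^ 4) / h) := by ring
    linarith
  have j₁ : Integrable (fun x => h ^ 3 + 128 / h * (W x + h ^ 4)) (sampleLaw μ f n θ₀) :=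
    (integrable_const _).add ((iW.add (integrable_const _)).const_mul _)
  have j₂ : Integrable (E.indicator (fun _ => (1 : ℝ))) (sampleLaw μ f n θ₀) :=
    (integrable_const _).indicator hE
  calc |∫ x, X x ∂(sampleLaw μ f n θ₀)| ≤ ∫ x, |X x| ∂(sampleLaw μ f n θ₀) :=
        abs_integral_le_integral_abs
    _ ≤ ∫ x, κ * (h ^ 3 + 128 / h * (W x + h ^ 4) + E.indicator (fun _ => 1) x)
          ∂(sampleLaw μ f n θ₀) :=
        integral_mono_of_nonneg (ae_of_all _ fun x => abs_nonneg _)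
          ((j₁.fun_add j₂).const_mul κ) hbound
    _ = κ * (h ^ 3 + 128 / h * ((∫ x, W x ∂(sampleLaw μ f n θ₀)) + h ^ 4)
          + (sampleLaw μ f n θ₀).real E) := by
        rw [integral_const_mul, integral_add j₁ j₂, integral_add (integrable_const _)
          ((iW.fun_add (integrable_const _)).const_mul _), integral_const_mul,
          integral_add iW (integrable_const _), integral_indicator_const _ hE]
        simp
    _ ≤ κ * (h ^ 3 + 128 / h * ((c₁ + c₂ + c₃) * h ^ 4 + h ^ 4) + |C| * h ^ 3) := by
        gcongr
        refine hEC.trans ?_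
        rw [← mul_one_div, ← hfour]
        refine mul_le_mul (le_abs_self C) ?_ (by positivity) (abs_nonneg C)
        exact pow_le_pow_of_le_one hpos.le hle (by norm_num)
    _ = _ := by field_simp; ring

end Expansion

/-! ### Bias and mean squared error of the estimators -/

section BiasMse

variable {D : Type*} [MeasurableSpace D] {μ : Measure D} {f : D → ℝ → ℝ} {a b : ℝ}

/-- The crude bounds on the remainders of the expansions that are used on the rare event. -/
theorem exists_crude_bound {I : ℝ} (hI : 0 < I) (J β Λ : ℝ) :
    ∃ κ : ℝ, 0 ≤ κ ∧ ∀ A B u d s : ℝ, |A| ≤ u → |B| ≤ u → |d| ≤ Λ → |s| ≤ |β| →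
      |d - A / I - (A * B / I ^ 2 + J * A ^ 2 / (2 * I ^ 3)) + s| ≤ κ * (1 + u ^ 4) ∧
      |d ^ 2 - (A / I) ^ 2| ≤ κ * (1 + u ^ 4) := by
  refine ⟨|Λ| + Λ ^ 2 + 1 / I + 1 / I ^ 2 + |J| / (2 * I ^ 3) + |β|, by positivity, ?_⟩
  intro A B u d s hA hB hd hs
  have hu : 0 ≤ u := (abs_nonneg A).trans hA
  have u1 : u ≤ 1 + u ^ 4 := by nlinarith [sq_nonneg (u - 1), sq_nonneg (u ^ 2 - 1)]
  have u2 : u ^ 2 ≤ 1 + u ^ 4 := by nlinarith [sq_nonneg (u ^ 2 - 1)]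
  have u0 : 1 ≤ 1 + u ^ 4 := by have := pow_nonneg hu 4; linarith
  set U := 1 + u ^ 4
  have hd' : |d| ≤ |Λ| := hd.trans (le_abs_self Λ)
  have a1 : |A / I| ≤ 1 / I * U := by
    rw [abs_div, abs_of_pos hI, div_mul_eq_mul_div, one_mul]
    exact div_le_div_of_nonneg_right (hA.trans u1) hI.le
  have a2 : |A * B / I ^ 2| ≤ 1 / I ^ 2 * U := by
    rw [abs_div, abs_of_pos (pow_pos hI 2), div_mul_eq_mul_div, one_mul, abs_mul]
    refine div_le_div_of_nonneg_right (le_trans ?_ u2) (by positivity)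
    rw [sq]; exact mul_le_mul hA hB (abs_nonneg _) hu
  have a3 : A ^ 2 ≤ u ^ 2 := by rw [← sq_abs]; exact pow_le_pow_left₀ (abs_nonneg _) hA 2
  have a4 : |J * A ^ 2 / (2 * I ^ 3)| ≤ |J| / (2 * I ^ 3) * U := by
    rw [abs_div, abs_of_pos (by positivity : 0 < 2 * I ^ 3), div_mul_eq_mul_div, abs_mul,
      abs_of_nonneg (sq_nonneg A)]
    exact div_le_div_of_nonneg_right (mul_le_mul_of_nonneg_left (a3.trans u2) (abs_nonneg _))
      (by positivity)
  have a5 : |(A / I) ^ 2| ≤ 1 / I ^ 2 * U := by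
    rw [abs_of_nonneg (sq_nonneg _), div_pow, div_mul_eq_mul_div, one_mul]
    exact div_le_div_of_nonneg_right (a3.trans u2) (by positivity)
  have a6 : |Λ| ≤ |Λ| * U := le_mul_of_one_le_right (abs_nonneg _) u0
  have a7 : |β| ≤ |β| * U := le_mul_of_one_le_right (abs_nonneg _) u0
  have a8 : |d ^ 2| ≤ Λ ^ 2 * U := by
    rw [abs_of_nonneg (sq_nonneg d)]
    exact (sq_le_sq.2 hd').trans (le_mul_of_one_le_right (sq_nonneg _) u0)
  have p1 : 0 ≤ Λ ^ 2 * U := by positivity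
  have p2 : 0 ≤ 1 / I * U := by positivity
  have p3 : 0 ≤ |J| / (2 * I ^ 3) * U := by positivity
  have p4 : 0 ≤ 1 / I ^ 2 * U := by positivity
  have p5 : 0 ≤ |Λ| * U := by positivity
  have p6 : 0 ≤ |β| * U := by positivity
  simp only [add_mul]
  constructor
  · have t1 := abs_add_le (d - A / I - (A * B / I ^ 2 + J * A ^ 2 / (2 * I ^ 3))) s
    have t2 := abs_sub (d - A / I) (A * B / I ^ 2 + J * A ^ 2 / (2 * I ^ 3))
    have t3 := abs_sub d (A / I)
    have t4 := abs_add_le (A * B / I ^ 2) (J * A ^ 2 / (2 * I ^ 3))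
    linarith
  · have t1 := abs_sub (d ^ 2) ((A / I) ^ 2)
    linarith

theorem measurable_bcMLE {mle : ∀ n : ℕ, (Fin n → D) → ℝ} (hmle : IsMLE f a b mle)
    (hreg : RegularModel μ f a b) (n : ℕ) : Measurable (bcMLE μ f a b mle n) := by
  have h1 := (hmle n).1
  have h2 := (measurable_indicator_biasCoeff hreg).comp h1
  exact measurable_const.max (measurable_const.min (h1.sub (h2.div_const _)))

theorem bcMLE_mem {D : Type*} [MeasurableSpace D] {μ : Measure D} {f : D → ℝ → ℝ} {a b : ℝ}
    (hab : a ≤ b) (mle : ∀ n : ℕ, (Fin n → D) → ℝ) (n : ℕ) (x : Fin n → D) :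
    bcMLE μ f a b mle n x ∈ Icc a b :=
  ⟨le_max_left _ _, max_le hab (min_le_left _ _)⟩

theorem abs_sub_le_of_mem_Icc {s t : ℝ} (hs : s ∈ Icc a b) (ht : t ∈ Icc a b) :
    |s - t| ≤ b - a := by
  rw [abs_le]; constructor <;> linarith [hs.1, hs.2, ht.1, ht.2]

theorem integral_quadraticPart (hreg : RegularModel μ f a b) {θ₀ : ℝ} (hθ₀ : θ₀ ∈ Ioo a b)
    {n : ℕ} (hn : n ≠ 0) :
    Integrable (fun x => quadraticPart μ f θ₀ (empMean n (fun y => logDeriv f 1 y θ₀) x)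
        (empMean n (centeredHessian μ f θ₀) x)) (sampleLaw μ f n θ₀) ∧
      ∫ x, quadraticPart μ f θ₀ (empMean n (fun y => logDeriv f 1 y θ₀) x)
        (empMean n (centeredHessian μ f θ₀) x) ∂(sampleLaw μ f n θ₀)
        = biasCoeff μ f θ₀ / n := by
  obtain ⟨M, hM⟩ := hreg.exists_isEnvelope
  have hP := hreg.prob θ₀ (Ioo_subset_Icc_self hθ₀)
  have m1 : Measurable fun y => logDeriv f 1 y θ₀ := measurable_logDeriv hreg (by norm_num) hθ₀
  have m2 := measurable_centeredHessian hreg hθ₀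
  have L1 := memLp_score hreg hθ₀
  have L2 := memLp_centeredHessian hreg hθ₀
  have h0 := integral_score_eq_zero hreg hθ₀
  have i1 := empMean_integrable_mul (n := n) L1 L2
  have i2 := empMean_integrable_mul (n := n) L1 L1
  have v1 := integral_empMean_mul hn m1 m2 L1 L2 h0
  have v2 := integral_empMean_mul hn m1 m1 L1 L1 h0
  have e12 : ∫ y, logDeriv f 1 y θ₀ * centeredHessian μ f θ₀ y ∂(law μ f θ₀)
      = ∫ y, logDeriv f 1 y θ₀ * logDeriv f 2 y θ₀ ∂(law μ f θ₀) := by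
    simp only [centeredHessian, mul_add]
    rw [integral_add, integral_mul_const, h0, zero_mul, add_zero]
    · exact (L1.mono_exponent (p := 2) (by norm_num)).integrable_mul
        ((hM.memLp_logDeriv hreg hθ₀ (j := 2) (by norm_num) (by norm_num)).mono_exponent
          (p := 2) (by norm_num))
    · exact (L1.integrable (by norm_num)).mul_const _
  have e11 : ∫ y, logDeriv f 1 y θ₀ * logDeriv f 1 y θ₀ ∂(law μ f θ₀)
      = fisherInfo μ f θ₀ := by simp only [fisherInfo, sq]
  rw [e12] at v1
  rw [e11] at v2
  have hI := hreg.fisher_pos θ₀ hθ₀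
  have hn' : (n : ℝ) ≠ 0 := by exact_mod_cast hn
  simp only [quadraticPart, sq (empMean n _ _)]
  have j1 := i1.div_const (fisherInfo μ f θ₀ ^ 2)
  have j2 := (i2.const_mul (∫ z, logDeriv f 3 z θ₀ ∂(law μ f θ₀))).div_const
    (2 * fisherInfo μ f θ₀ ^ 3)
  refine ⟨j1.add j2, ?_⟩
  rw [sampleLaw, integral_add j1 j2, integral_div, integral_div, integral_const_mul, v1, v2,
    biasCoeff]
  field_simp

/-- First-order bias of the MLE, and bias and mean squared error of the bias-corrected MLE. -/
theorem IsMLE.exists_moment_expansions {mle : ∀ n : ℕ, (Fin n → D) → ℝ}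
    (hmle : IsMLE f a b mle) (hreg : RegularModel μ f a b) {θ₀ : ℝ} (hθ₀ : θ₀ ∈ Ioo a b) :
    ∃ C : ℝ, 0 ≤ C ∧ ∀ n : ℕ, 1 ≤ n →
      |(∫ x, (mle n x - θ₀) ∂(sampleLaw μ f n θ₀)) - biasCoeff μ f θ₀ / n|
        ≤ C * (1 / √n) ^ 3 ∧
      |∫ x, (bcMLE μ f a b mle n x - θ₀) ∂(sampleLaw μ f n θ₀)| ≤ C * (1 / √n) ^ 3 ∧
      ∫ x, (bcMLE μ f a b mle n x - θ₀) ^ 2 ∂(sampleLaw μ f n θ₀)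
        ≤ 1 / (n * fisherInfo μ f θ₀) + C * (1 / √n) ^ 3 := by
  have hθ₀' := Ioo_subset_Icc_self hθ₀
  have hP := hreg.prob θ₀ hθ₀'
  have hPn := isProbabilityMeasure_sampleLaw hreg hθ₀'
  have hI := hreg.fisher_pos θ₀ hθ₀
  obtain ⟨κ₁, hκ₁, C₀, E, mE, hE, hexp⟩ := hmle.exists_expansion_event hreg hθ₀
  obtain ⟨κ₂, hκ₂, hcrude⟩ := exists_crude_bound hI (∫ z, logDeriv f 3 z θ₀ ∂(law μ f θ₀))
    (biasCoeff μ f θ₀) (b - a)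
  obtain ⟨C, hC⟩ := exists_integral_remainder_le hreg hθ₀ (κ₁ + κ₂) (by positivity) C₀
  refine ⟨|C|, abs_nonneg C, fun n hn => ?_⟩
  have hn0 : n ≠ 0 := by omega
  have hn' : (0 : ℝ) < n := by exact_mod_cast hn
  set A : (Fin n → D) → ℝ := empMean n (fun y => logDeriv f 1 y θ₀) with hA
  set B : (Fin n → D) → ℝ := empMean n (centeredHessian μ f θ₀) with hB
  have m1 : Measurable fun y => logDeriv f 1 y θ₀ := measurable_logDeriv hreg (by norm_num) hθ₀
  have L1 := memLp_score hreg hθ₀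
  obtain ⟨iQ, vQ⟩ := integral_quadraticPart hreg hθ₀ hn0
  rw [← hA, ← hB] at iQ vQ
  have iA : Integrable A (sampleLaw μ f n θ₀) := (memLp_empMean L1).integrable (by norm_num)
  have vA : ∫ x, A x ∂(sampleLaw μ f n θ₀) = 0 := by
    rw [hA, sampleLaw, integral_empMean hn0 (L1.integrable (by norm_num)),
      integral_score_eq_zero hreg hθ₀]
  have iA2 : Integrable (fun x => (A x / fisherInfo μ f θ₀) ^ 2) (sampleLaw μ f n θ₀) := by
    simp only [div_pow]
    exact (integrable_pow_of_memLp_four (memLp_empMean L1) (by norm_num)).div_const _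
  have vA2 : ∫ x, (A x / fisherInfo μ f θ₀) ^ 2 ∂(sampleLaw μ f n θ₀)
      = 1 / (n * fisherInfo μ f θ₀) := by
    have h := integral_empMean_mul hn0 m1 m1 L1 L1 (integral_score_eq_zero hreg hθ₀)
    have e : ∫ y, logDeriv f 1 y θ₀ * logDeriv f 1 y θ₀ ∂(law μ f θ₀)
        = fisherInfo μ f θ₀ := by simp only [fisherInfo, sq]
    simp only [div_pow]
    rw [integral_div]
    simp only [sq (A _)]
    rw [sampleLaw, hA, h, e]
    field_simp
  have bd : ∀ x, |mle n x - θ₀| ≤ b - a := fun x =>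
    abs_sub_le_of_mem_Icc ((hmle n).2 x).1 hθ₀'
  have bZ : ∀ x, |bcMLE μ f a b mle n x - θ₀| ≤ b - a := fun x =>
    abs_sub_le_of_mem_Icc (bcMLE_mem hreg.lt.le mle n x) hθ₀'
  have md : Measurable fun x => mle n x - θ₀ := (hmle n).1.sub_const _
  have mZ : Measurable fun x => bcMLE μ f a b mle n x - θ₀ :=
    (measurable_bcMLE hmle hreg n).sub_const _
  have id : Integrable (fun x => mle n x - θ₀) (sampleLaw μ f n θ₀) :=
    (integrable_const (b - a)).mono' md.aestronglyMeasurable (ae_of_all _ bd)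
  have iZ : Integrable (fun x => bcMLE μ f a b mle n x - θ₀) (sampleLaw μ f n θ₀) :=
    (integrable_const (b - a)).mono' mZ.aestronglyMeasurable (ae_of_all _ bZ)
  have iZ2 : Integrable (fun x => (bcMLE μ f a b mle n x - θ₀) ^ 2) (sampleLaw μ f n θ₀) :=
    (integrable_const ((b - a) ^ 2)).mono' (mZ.pow_const 2).aestronglyMeasurable
      (ae_of_all _ fun x => by
        rw [Real.norm_eq_abs, abs_of_nonneg (sq_nonneg _), ← sq_abs]
        exact pow_le_pow_left₀ (abs_nonneg _) (bZ x) 2)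
  have hβn : |biasCoeff μ f θ₀ / n| ≤ |biasCoeff μ f θ₀| := by
    rw [abs_div, abs_of_pos hn']
    exact div_le_self (abs_nonneg _) (by exact_mod_cast hn)
  have hs : ∀ x, |A x| ≤ scale μ f θ₀ n x ∧ |B x| ≤ scale μ f θ₀ n x
      ∧ 0 ≤ scale μ f θ₀ n x := fun x => by
    have p0 : (0 : ℝ) ≤ 1 / √n := by positivity
    have p1 := abs_nonneg (A x)
    have p2 := abs_nonneg (B x)
    have p3 := abs_nonneg (empMean n (centeredThird μ f θ₀) x)
    have e : scale μ f θ₀ n x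
        = |A x| + |B x| + |empMean n (centeredThird μ f θ₀) x| + 1 / √n := rfl
    refine ⟨?_, ?_, ?_⟩ <;> linarith
  -- the expansion outside `E n` and the crude bound on `E n`, combined
  have hglue : ∀ (x : Fin n → D) (r : ℝ), (x ∉ E n → |r| ≤ κ₁ * scale μ f θ₀ n x ^ 3) →
      |r| ≤ κ₂ * (1 + scale μ f θ₀ n x ^ 4) →
      |r| ≤ (κ₁ + κ₂) * (scale μ f θ₀ n x ^ 3 + scale μ f θ₀ n x ^ 4
        + (E n).indicator (fun _ => 1) x) := fun x r h1 h2 => by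
    have q3 := pow_nonneg (hs x).2.2 3
    have q4 := pow_nonneg (hs x).2.2 4
    by_cases hx : x ∈ E n
    · rw [indicator_of_mem hx]
      refine h2.trans (mul_le_mul (by linarith) (by linarith) (by positivity) (by positivity))
    · rw [indicator_of_notMem hx]
      refine (h1 hx).trans (mul_le_mul (by linarith) (by linarith) q3 (by positivity))
  have hC' : C * (1 / √(n : ℝ)) ^ 3 ≤ |C| * (1 / √(n : ℝ)) ^ 3 :=
    mul_le_mul_of_nonneg_right (le_abs_self C) (by positivity)
  have key := fun X hX => (hC n hn (E n) (mE n) (hE n hn) X hX).trans hC'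
  have iAI := iA.div_const (fisherInfo μ f θ₀)
  refine ⟨?_, ?_, ?_⟩
  · have h := key (fun x => mle n x - θ₀ - A x / fisherInfo μ f θ₀
        - quadraticPart μ f θ₀ (A x) (B x)) (by
      filter_upwards [ae_sampleLaw_pos hreg hθ₀' n] with x hx
      refine hglue x _ (fun hxE => (hexp n hn x hx hxE (A x) (B x) rfl rfl).1) ?_
      have := (hcrude (A x) (B x) (scale μ f θ₀ n x) (mle n x - θ₀) 0 (hs x).1 (hs x).2.1 (bd x)
        (by simp)).1
      rwa [add_zero] at this)
    rwa [integral_sub (Integrable.sub' id iAI) iQ, integral_sub id iAI, integral_div, vA, vQ,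
      zero_div, sub_zero] at h
  · have h := key (fun x => bcMLE μ f a b mle n x - θ₀ - A x / fisherInfo μ f θ₀
        - quadraticPart μ f θ₀ (A x) (B x) + biasCoeff μ f θ₀ / n) (by
      filter_upwards [ae_sampleLaw_pos hreg hθ₀' n] with x hx
      refine hglue x _ (fun hxE => (hexp n hn x hx hxE (A x) (B x) rfl rfl).2.1) ?_
      exact (hcrude (A x) (B x) (scale μ f θ₀ n x) (bcMLE μ f a b mle n x - θ₀)
        (biasCoeff μ f θ₀ / n) (hs x).1 (hs x).2.1 (bZ x) hβn).1)
    rw [integral_add (Integrable.sub' (Integrable.sub' iZ iAI) iQ) (integrable_const _),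
      integral_sub (Integrable.sub' iZ iAI) iQ,
      integral_sub iZ iAI, integral_div, vA, vQ, zero_div, sub_zero] at h
    simpa using h
  · have h := key (fun x => (bcMLE μ f a b mle n x - θ₀) ^ 2 - (A x / fisherInfo μ f θ₀) ^ 2) (by
      filter_upwards [ae_sampleLaw_pos hreg hθ₀' n] with x hx
      refine hglue x _ (fun hxE => (hexp n hn x hx hxE (A x) (B x) rfl rfl).2.2) ?_
      exact (hcrude (A x) (B x) (scale μ f θ₀ n x) (bcMLE μ f a b mle n x - θ₀) 0
        (hs x).1 (hs x).2.1 (bZ x) (by simp)).2)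
    rw [integral_sub iZ2 iA2, vA2] at h
    linarith [le_abs_self (∫ x, (bcMLE μ f a b mle n x - θ₀) ^ 2 ∂(sampleLaw μ f n θ₀)
      - 1 / (n * fisherInfo μ f θ₀))]

end BiasMse

/-! ### The Laplace mechanism -/

section Laplace

variable {s : ℝ}

theorem integral_abs_pow_mul_exp (hs : 0 < s) (k : ℕ) :
    ∫ y : ℝ, |y| ^ k * Real.exp (-(|y| / s)) = 2 * (k.factorial * s ^ (k + 1)) := by
  rw [integral_comp_abs (f := fun y => y ^ k * Real.exp (-(y / s)))]
  have h := Real.integral_rpow_mul_exp_neg_mul_Ioi (a := k + 1) (r := 1 / s) (by positivity)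
    (by positivity)
  rw [Real.Gamma_nat_eq_factorial, one_div_one_div] at h
  have e : ∫ t in Ioi (0 : ℝ), t ^ ((k : ℝ) + 1 - 1) * Real.exp (-(1 / s * t))
      = ∫ t in Ioi (0 : ℝ), t ^ k * Real.exp (-(t / s)) := by
    refine setIntegral_congr_fun measurableSet_Ioi fun t _ => ?_
    rw [add_sub_cancel_right, Real.rpow_natCast, one_div_mul_eq_div]
  rw [← e, h]
  norm_cast
  ring

theorem integrable_abs_pow_mul_exp (hs : 0 < s) (k : ℕ) :
    Integrable fun y : ℝ => |y| ^ k * Real.exp (-(|y| / s)) := by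
  refine Integrable.of_integral_ne_zero ?_
  rw [integral_abs_pow_mul_exp hs]
  positivity

theorem lintegral_laplace {g : ℝ → ℝ} (hg : Measurable g) (hs : 0 < s) :
    ∫⁻ y, ENNReal.ofReal (g y) ∂(laplace s)
      = ∫⁻ y, ENNReal.ofReal (1 / (2 * s) * (g y * Real.exp (-(|y| / s)))) := by
  rw [laplace, lintegral_withDensity_eq_lintegral_mul _ (by fun_prop) hg.ennreal_ofReal]
  refine lintegral_congr fun y => ?_
  rw [Pi.mul_apply, ← ENNReal.ofReal_mul (by positivity)]
  congr 1
  ring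

theorem isProbabilityMeasure_laplace (hs : 0 < s) : IsProbabilityMeasure (laplace s) := by
  constructor
  have h := lintegral_laplace (measurable_const (a := (1 : ℝ))) hs
  simp only [ENNReal.ofReal_one, lintegral_const, one_mul] at h
  rw [h, ← ofReal_integral_eq_lintegral_ofReal
    (by simpa using (integrable_abs_pow_mul_exp hs 0).const_mul (1 / (2 * s)))
    (ae_of_all _ fun y => by positivity), integral_const_mul]
  have := integral_abs_pow_mul_exp hs 0
  simp only [pow_zero, one_mul] at this
  rw [this]
  simp
  field_simp

/-- Mean squared deviation under additive Laplace noise. -/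
theorem lintegral_sq_add_laplace (hs : 0 < s) (v : ℝ) :
    ∫⁻ y, ENNReal.ofReal ((v + y) ^ 2) ∂(laplace s) = ENNReal.ofReal (v ^ 2 + 2 * s ^ 2) := by
  have i0 := integrable_abs_pow_mul_exp hs 0
  have i1' := integrable_abs_pow_mul_exp hs 1
  have i2 := integrable_abs_pow_mul_exp hs 2
  have v0 := integral_abs_pow_mul_exp hs 0
  have v2 := integral_abs_pow_mul_exp hs 2
  simp only [pow_zero, one_mul, sq_abs] at i0 i2 v0 v2
  have i1 : Integrable fun y : ℝ => y * Real.exp (-(|y| / s)) :=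
    i1'.mono' (by fun_prop) (ae_of_all _ fun y => by simp)
  have v1 : ∫ y : ℝ, y * Real.exp (-(|y| / s)) = 0 := by
    have h := integral_neg_eq_self (fun y : ℝ => y * Real.exp (-(|y| / s))) volume
    simp only [abs_neg, neg_mul, integral_neg] at h
    linarith
  have e : ∀ y : ℝ, 1 / (2 * s) * ((v + y) ^ 2 * Real.exp (-(|y| / s)))
      = 1 / (2 * s) * (v ^ 2 * Real.exp (-(|y| / s)) + 2 * v * (y * Real.exp (-(|y| / s)))
        + y ^ 2 * Real.exp (-(|y| / s))) := fun y => by ring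
  have i := (((i0.const_mul (v ^ 2)).fun_add (i1.const_mul (2 * v))).fun_add i2).const_mul
    (1 / (2 * s))
  rw [lintegral_laplace (by fun_prop) hs, ← ofReal_integral_eq_lintegral_ofReal
    (by simp_rw [e]; exact i) (ae_of_all _ fun y => by positivity)]
  simp_rw [e]
  rw [integral_const_mul, integral_add ((i0.const_mul (v ^ 2)).fun_add (i1.const_mul (2 * v))) i2,
    integral_add (i0.const_mul (v ^ 2)) (i1.const_mul (2 * v)), integral_const_mul,
    integral_const_mul, v0, v1, v2]
  congr 1
  simp
  field_simp

theorem laplace_map_add_apply (c : ℝ) {S : Set ℝ} (hS : MeasurableSet S) :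
    (laplace s).map (fun r => c + r) S
      = ∫⁻ y in S, ENNReal.ofReal (1 / (2 * s) * Real.exp (-(|y - c| / s))) := by
  rw [Measure.map_apply (by fun_prop) hS, laplace,
    withDensity_apply _ (hS.preimage (by fun_prop)), ← lintegral_indicator hS,
    ← lintegral_indicator (hS.preimage (by fun_prop)),
    ← lintegral_add_left_eq_self (S.indicator _) c]
  refine lintegral_congr fun y => ?_
  simp only [indicator, add_sub_cancel_left]
  rfl

/-- Privacy of the Laplace mechanism: shifting the noise by at most `s ε` changes its density by a
factor of at most `exp ε`. -/
theorem laplace_map_add_le (hs : 0 < s) {c c' ε : ℝ} (h : |c - c'| ≤ s * ε) {S : Set ℝ}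
    (hS : MeasurableSet S) :
    (laplace s).map (fun r => c + r) S
      ≤ ENNReal.ofReal (Real.exp ε) * (laplace s).map (fun r => c' + r) S := by
  rw [laplace_map_add_apply c hS, laplace_map_add_apply c' hS, ← lintegral_const_mul _
    (by fun_prop)]
  refine lintegral_mono fun y => ?_
  rw [← ENNReal.ofReal_mul (Real.exp_pos _).le]
  refine ENNReal.ofReal_le_ofReal ?_
  rw [mul_left_comm, ← Real.exp_add]
  refine mul_le_mul_of_nonneg_left (Real.exp_le_exp.2 ?_) (by positivity)
  have h1 : |y - c'| ≤ |y - c| + |c - c'| := abs_sub_le y c c'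
  have h2 : |y - c'| / s ≤ |y - c| / s + ε := by
    rw [div_le_iff₀ hs, add_mul, div_mul_cancel₀ _ hs.ne']
    linarith
  linarith

theorem measurable_laplace_map_add {X : Type*} [MeasurableSpace X] (hs : 0 < s) {c : X → ℝ}
    (hc : Measurable c) : Measurable fun x => (laplace s).map (fun r => c x + r) := by
  have := isProbabilityMeasure_laplace hs
  refine Measure.measurable_of_measurable_coe _ fun S hS => ?_
  have h : ∀ x, (laplace s).map (fun r => c x + r) S
      = laplace s (Prod.mk x ⁻¹' {p : X × ℝ | c p.1 + p.2 ∈ S}) := fun x => by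
    rw [Measure.map_apply (by fun_prop) hS]; rfl
  simp_rw [h]
  exact measurable_measure_prodMk_left
    (((hc.comp measurable_fst).add measurable_snd) hS)

end Laplace

/-! ### Blocks of the sample -/

section Blocks

open ProbabilityTheory

variable {D : Type*}

theorem measurable_block [MeasurableSpace D] {n k : ℕ} (j : Fin k) :
    Measurable fun x : Fin n → D => block x j := by
  unfold block; fun_prop

theorem block_index_div {n k : ℕ} (j : Fin k) (i : Fin (n / k)) :
    ((j : ℕ) * (n / k) + i) / (n / k) = j := by
  have h : 0 < n / k := i.pos
  rw [Nat.add_comm, Nat.add_mul_div_right _ _ h, Nat.div_eq_of_lt i.isLt, Nat.zero_add]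

/-- Changing one data point changes at most one block. -/
theorem Neighbors.exists_block_eq {n k : ℕ} (hk : 1 ≤ k) {x x' : Fin n → D}
    (h : Neighbors x x') : ∃ j₀ : Fin k, ∀ j, j ≠ j₀ → block x j = block x' j := by
  obtain ⟨i, hi⟩ := h
  set j₀ : Fin k := if h : (i : ℕ) / (n / k) < k then ⟨_, h⟩ else ⟨0, hk⟩ with hj₀
  refine ⟨j₀, fun j hj => funext fun l => hi _ fun he => hj ?_⟩
  have h1 : (i : ℕ) / (n / k) = j := by
    rw [← he]; exact block_index_div j l
  rw [hj₀, dif_pos (by rw [h1]; exact j.isLt)]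
  exact Fin.ext h1.symm

variable [MeasurableSpace D] (P : Measure D) [IsProbabilityMeasure P]

theorem iIndepFun_eval (n : ℕ) :
    iIndepFun (fun (i : Fin n) (x : Fin n → D) => x i) (Measure.pi fun _ => P) :=
  iIndepFun_pi (X := fun _ => id) fun _ => aemeasurable_id

theorem measurePreserving_block {n k : ℕ} (j : Fin k) :
    MeasurePreserving (fun x : Fin n → D => block x j) (Measure.pi fun _ => P)
      (Measure.pi fun _ => P) := by
  refine ⟨measurable_block j, ?_⟩
  have hinj : Function.Injective fun i : Fin (n / k) =>
      (⟨(j : ℕ) * (n / k) + i, blockIndex_lt j i⟩ : Fin n) := fun i i' h => by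
    simpa [Fin.ext_iff] using h
  have h := (iIndepFun_iff_map_fun_eq_pi_map (fun i => (measurable_pi_apply _).aemeasurable)).1
    ((iIndepFun_eval P n).precomp hinj)
  refine h.trans ?_
  congr 1
  ext1 i
  exact (measurePreserving_eval (fun _ : Fin n => P) _).map_eq

theorem indepFun_block {n k : ℕ} {j j' : Fin k} (hj : j ≠ j') :
    IndepFun (fun x : Fin n → D => block x j) (fun x => block x j')
      (Measure.pi fun _ => P) := by
  set S : Fin k → Finset (Fin n) := fun j => Finset.univ.image fun i : Fin (n / k) =>
    (⟨(j : ℕ) * (n / k) + i, blockIndex_lt j i⟩ : Fin n) with hS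
  have hdisj : Disjoint (S j) (S j') := by
    rw [Finset.disjoint_left]
    intro i h1 h2
    simp only [hS, Finset.mem_image, Finset.mem_univ, true_and] at h1 h2
    obtain ⟨l, rfl⟩ := h1
    obtain ⟨l', hl'⟩ := h2
    have := congrArg (fun z : Fin n => (z : ℕ) / (n / k)) hl'
    simp only [block_index_div] at this
    exact hj (Fin.ext this.symm)
  have h := (iIndepFun_eval P n).indepFun_finset (S j) (S j') hdisj
    (fun i => measurable_pi_apply i)
  have hmem : ∀ (j : Fin k) (l : Fin (n / k)),
      (⟨(j : ℕ) * (n / k) + l, blockIndex_lt j l⟩ : Fin n) ∈ S j := fun j l =>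
    Finset.mem_image_of_mem _ (Finset.mem_univ l)
  exact h.comp (φ := fun v l => v ⟨_, hmem j l⟩) (ψ := fun v l => v ⟨_, hmem j' l⟩)
    (measurable_pi_lambda _ fun l => measurable_pi_apply _)
    (measurable_pi_lambda _ fun l => measurable_pi_apply _)

/-- Second moment of a mean of pairwise independent variables with common first two moments. -/
theorem integral_sq_mean_le {Ω : Type*} [MeasurableSpace Ω] {Q : Measure Ω}
    [IsProbabilityMeasure Q] {k : ℕ} (hk : 1 ≤ k) {X : Fin k → Ω → ℝ}
    (hX : ∀ j, MemLp (X j) 2 Q) (hind : ∀ i j, i ≠ j → IndepFun (X i) (X j) Q) {m v : ℝ}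
    (hm : ∀ j, ∫ ω, X j ω ∂Q = m) (hv : ∀ j, ∫ ω, X j ω ^ 2 ∂Q = v) :
    ∫ ω, (1 / (k : ℝ) * ∑ j, X j ω) ^ 2 ∂Q ≤ v / k + m ^ 2 := by
  have hk' : (0 : ℝ) < k := by exact_mod_cast hk
  have hint : ∀ i j, Integrable (fun ω => X i ω * X j ω) Q := fun i j =>
    (hX i).integrable_mul (hX j)
  have hval : ∀ i j, ∫ ω, X i ω * X j ω ∂Q ≤ (if j = i then v else 0) + m ^ 2 := by
    intro i j
    split_ifs with h
    · subst h
      simp only [← sq, hv]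
      linarith [sq_nonneg m]
    · rw [(hind i j (Ne.symm h)).integral_fun_mul_eq_mul_integral (hX i).1 (hX j).1, hm, hm]
      linarith [sq m]
  have e : ∀ ω, (1 / (k : ℝ) * ∑ j, X j ω) ^ 2
      = 1 / (k : ℝ) ^ 2 * ∑ i, ∑ j, X i ω * X j ω := fun ω => by
    rw [mul_pow, sq (∑ j, X j ω), Finset.sum_mul_sum]; ring
  simp_rw [e]
  rw [integral_const_mul, integral_finsetSum _ fun i _ => integrable_finsetSum _ fun j _ =>
    hint i j]
  simp_rw [integral_finsetSum _ fun j _ => hint _ j]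
  calc _ ≤ 1 / (k : ℝ) ^ 2 * ∑ i : Fin k, ∑ j : Fin k, ((if j = i then v else 0) + m ^ 2) := by
        gcongr with i _ j _
        exact hval i j
    _ = _ := by
        simp [Finset.sum_add_distrib]
        field_simp

end Blocks

/-! ### The sample-and-aggregate estimator -/

section SampleAggregate

open ProbabilityTheory

variable {D : Type*} [MeasurableSpace D] {μ : Measure D} {f : D → ℝ → ℝ} {a b : ℝ}
  {mle : ∀ n : ℕ, (Fin n → D) → ℝ}

theorem isRandomizedEstimator_sampleAggregate (hreg : RegularModel μ f a b)
    (hmle : IsMLE f a b mle) {ε : ℝ} (hε : 0 < ε) {k : ℕ} (hk : 1 ≤ k) (n : ℕ) :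
    IsRandomizedEstimator (sampleAggregate μ f a b mle ε k n) := by
  have hk' : (0 : ℝ) < k := by exact_mod_cast hk
  have hs : 0 < (b - a) / (k * ε) := div_pos (sub_pos.2 hreg.lt) (by positivity)
  have := isProbabilityMeasure_laplace hs
  refine ⟨measurable_laplace_map_add hs ?_, fun x => ?_⟩
  · exact (Finset.measurable_fun_sum _ fun j _ =>
      (measurable_bcMLE hmle hreg _).comp (measurable_block j)).const_mul _
  · exact Measure.isProbabilityMeasure_map (by fun_prop)

theorem isDifferentiallyPrivate_sampleAggregate (hreg : RegularModel μ f a b) {ε : ℝ}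
    (hε : 0 < ε) {k : ℕ} (hk : 1 ≤ k) (n : ℕ) :
    IsDifferentiallyPrivate ε (sampleAggregate μ f a b mle ε k n) := by
  have hk' : (0 : ℝ) < k := by exact_mod_cast hk
  have hs : 0 < (b - a) / (k * ε) := div_pos (sub_pos.2 hreg.lt) (by positivity)
  intro x x' hx S hS
  refine laplace_map_add_le hs ?_ hS
  obtain ⟨j₀, hj₀⟩ := hx.exists_block_eq hk
  rw [← mul_sub, ← Finset.sum_sub_distrib, Finset.sum_eq_single j₀
    (fun j _ hj => by rw [hj₀ j hj, sub_self]) (by simp), abs_mul, abs_of_pos (by positivity)]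
  have h := abs_sub_le_of_mem_Icc (bcMLE_mem (μ := μ) (f := f) hreg.lt.le mle (n / k) (block x j₀))
    (bcMLE_mem (μ := μ) (f := f) hreg.lt.le mle (n / k) (block x' j₀))
  calc _ ≤ 1 / (k : ℝ) * (b - a) := mul_le_mul_of_nonneg_left h (by positivity)
    _ = _ := by field_simp

/-- The mean squared error is the mean squared deviation of the average of the block estimators
plus the variance of the noise. -/
theorem mse_sampleAggregate_le (hreg : RegularModel μ f a b) (hmle : IsMLE f a b mle)
    {θ : ℝ} (hθ : θ ∈ Icc a b) {ε : ℝ} (hε : 0 < ε) {k : ℕ} (hk : 1 ≤ k) (n : ℕ) :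
    mse μ f (sampleAggregate μ f a b mle ε k n) θ ≤ ENNReal.ofReal (
      (∫ x, (bcMLE μ f a b mle (n / k) x - θ) ^ 2 ∂(sampleLaw μ f (n / k) θ)) / k
        + (∫ x, (bcMLE μ f a b mle (n / k) x - θ) ∂(sampleLaw μ f (n / k) θ)) ^ 2
        + 2 * ((b - a) / (k * ε)) ^ 2) := by
  have hP := hreg.prob θ hθ
  have hPn := isProbabilityMeasure_sampleLaw hreg hθ
  have hk' : (0 : ℝ) < k := by exact_mod_cast hk
  set s := (b - a) / (k * ε) with hsdef
  have hs : 0 < s := div_pos (sub_pos.2 hreg.lt) (by positivity)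
  set g : (Fin (n / k) → D) → ℝ := fun y => bcMLE μ f a b mle (n / k) y - θ with hg
  have mg : Measurable g := (measurable_bcMLE hmle hreg _).sub_const _
  have bg : ∀ y, |g y| ≤ b - a := fun y =>
    abs_sub_le_of_mem_Icc (bcMLE_mem hreg.lt.le mle _ y) hθ
  set X : Fin k → (Fin n → D) → ℝ := fun j x => g (block x j) with hX
  have mX : ∀ j, Measurable (X j) := fun j => mg.comp (measurable_block j)
  have LX : ∀ j, MemLp (X j) 2 (sampleLaw μ f n θ) := fun j =>
    MemLp.of_bound (mX j).aestronglyMeasurable (b - a) (ae_of_all _ fun x => bg _)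
  have hinner : ∀ x, ∫⁻ y, ENNReal.ofReal ((y - θ) ^ 2) ∂(sampleAggregate μ f a b mle ε k n x)
      = ENNReal.ofReal ((1 / (k : ℝ) * ∑ j, X j x) ^ 2 + 2 * s ^ 2) := fun x => by
    rw [sampleAggregate, lintegral_map (by fun_prop) (by fun_prop), ← lintegral_sq_add_laplace hs]
    refine lintegral_congr fun y => ?_
    congr 2
    simp only [hX, hg, Finset.sum_sub_distrib]
    simp
    field_simp
    ring
  have iX : Integrable (fun x => (1 / (k : ℝ) * ∑ j, X j x) ^ 2) (sampleLaw μ f n θ) :=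
    ((memLp_finsetSum Finset.univ fun j _ => LX j).const_mul (1 / (k : ℝ))).integrable_sq
  have hmean : ∀ {G : (Fin (n / k) → D) → ℝ}, Measurable G → ∀ j : Fin k,
      ∫ x, G (block x j) ∂(sampleLaw μ f n θ) = ∫ y, G y ∂(sampleLaw μ f (n / k) θ) := by
    intro G mG j
    have h := measurePreserving_block (law μ f θ) (n := n) j
    rw [sampleLaw, sampleLaw, ← h.map_eq, integral_map h.measurable.aemeasurable
      mG.aestronglyMeasurable]
  have key := integral_sq_mean_le hk LX (fun i j hij => (indepFun_block (law μ f θ) hij).comp mg mg)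
    (fun j => hmean mg j) (fun j => hmean (mg.pow_const 2) j)
  rw [mse]
  simp_rw [hinner]
  rw [← ofReal_integral_eq_lintegral_ofReal (iX.fun_add (integrable_const _))
    (ae_of_all _ fun x => by positivity), integral_add iX (integrable_const _)]
  refine ENNReal.ofReal_le_ofReal (add_le_add key ?_)
  simp

end SampleAggregate

/-! ### The number of blocks -/

/-- All rates are powers with denominator five; in terms of fifth roots their identities become
rational ones. -/
theorem exists_fifth_root {x : ℝ} (hx : 0 < x) : ∃ z : ℝ, 0 < z ∧ z ^ 5 = x ∧
    x ^ (2 / 5 : ℝ) = z ^ 2 ∧ x ^ (3 / 5 : ℝ) = z ^ 3 ∧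
    x ^ (-(1 / 5) : ℝ) = 1 / z ∧ x ^ (-(2 / 5) : ℝ) = 1 / z ^ 2 ∧
    x ^ (-(6 / 5) : ℝ) = 1 / z ^ 6 := by
  have h : ∀ k : ℕ, (x ^ (1 / 5 : ℝ)) ^ k = x ^ (k / 5 : ℝ) := fun k => by
    rw [← Real.rpow_natCast, ← Real.rpow_mul hx.le]; congr 1; ring
  refine ⟨x ^ (1 / 5 : ℝ), by positivity, ?_, ?_, ?_, ?_, ?_, ?_⟩
  · rw [h]; norm_num
  · rw [h]; norm_num
  · rw [h]; norm_num
  · rw [Real.rpow_neg hx.le, one_div, one_div]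
  · rw [Real.rpow_neg hx.le, h, one_div]; norm_num
  · rw [Real.rpow_neg hx.le, h, one_div]; norm_num

theorem numBlocks_bounds {Λ ε : ℝ} (hΛ : 0 < Λ) (hε : 0 < ε) {n : ℕ} (hn : 1 ≤ n) :
    1 ≤ numBlocks Λ ε n ∧
      (n : ℝ) ^ (3 / 5 : ℝ) * Λ ^ (2 / 5 : ℝ) / ε ^ (2 / 5 : ℝ) ≤ numBlocks Λ ε n ∧
      (numBlocks Λ ε n : ℝ) ≤ (n : ℝ) ^ (3 / 5 : ℝ) * Λ ^ (2 / 5 : ℝ) / ε ^ (2 / 5 : ℝ) + 1 := by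
  have hn' : (0 : ℝ) < n := by exact_mod_cast hn
  have h0 : 0 < (n : ℝ) ^ (3 / 5 : ℝ) * Λ ^ (2 / 5 : ℝ) / ε ^ (2 / 5 : ℝ) := by positivity
  exact ⟨Nat.ceil_pos.2 h0, Nat.le_ceil _, (Nat.ceil_lt_add_one h0.le).le⟩

section Rates

variable {D : Type*} [MeasurableSpace D] {μ : Measure D} {f : D → ℝ → ℝ} {a b : ℝ}
  {mle : ∀ n : ℕ, (Fin n → D) → ℝ}

/-- Mean squared error of sample-and-aggregate in terms of `r = k / n`, the inverse of the block
length: `√r` is the relative loss from splitting the sample, `r³ n` comes from the squared bias of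
the block estimators, and the last term from the noise. -/
theorem exists_mse_numBlocks_le (hreg : RegularModel μ f a b) (hmle : IsMLE f a b mle) {θ : ℝ}
    (hθ : θ ∈ Ioo a b) : ∃ C : ℝ, 0 ≤ C ∧ ∀ (n : ℕ) (ε : ℝ), 1 ≤ n → 0 < ε →
      ∀ r : ℝ, r = (numBlocks (b - a) ε n : ℝ) / n →
      mse μ f (sampleAggregate μ f a b mle ε (numBlocks (b - a) ε n) n) θ
        ≤ ENNReal.ofReal (1 / (n * fisherInfo μ f θ) * (1 + C * (√r + r ^ 3 * n
          + (n : ℝ) ^ (-(1 / 5) : ℝ) * ε ^ (-(6 / 5) : ℝ)))) := by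
  have hθ' := Ioo_subset_Icc_self hθ
  have hPn := isProbabilityMeasure_sampleLaw hreg hθ'
  have hI := hreg.fisher_pos θ hθ
  set I := fisherInfo μ f θ with hIdef
  obtain ⟨C, hC, hmom⟩ := hmle.exists_moment_expansions hreg hθ
  have hΛ : 0 < b - a := sub_pos.2 hreg.lt
  obtain ⟨l, hl, hl5, hl2, -⟩ := exists_fifth_root hΛ
  set Λ := b - a with hΛdef
  refine ⟨2 + 4 * C * I + 8 * C ^ 2 * I + 16 * I * Λ ^ 2 + 2 * I * l ^ 6, by positivity, ?_⟩
  intro n ε hn hε r hr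
  have hn' : (0 : ℝ) < n := by exact_mod_cast hn
  obtain ⟨hk1, hk2, -⟩ := numBlocks_bounds hΛ hε hn
  set k := numBlocks Λ ε n with hk
  have hk' : (0 : ℝ) < k := by exact_mod_cast hk1
  have hr0 : 0 < r := by rw [hr]; positivity
  set q := (n : ℝ) ^ (-(1 / 5) : ℝ) * ε ^ (-(6 / 5) : ℝ) with hq
  have hq0 : 0 ≤ q := by positivity
  refine (mse_sampleAggregate_le hreg hmle hθ' hε hk1 n).trans (ENNReal.ofReal_le_ofReal ?_)
  rw [← hΛdef]
  set m := ∫ x, (bcMLE μ f a b mle (n / k) x - θ) ∂(sampleLaw μ f (n / k) θ) with hm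
  set v := ∫ x, (bcMLE μ f a b mle (n / k) x - θ) ^ 2 ∂(sampleLaw μ f (n / k) θ) with hv
  have hnoise : 2 * (Λ / (k * ε)) ^ 2 ≤ 1 / (n * I) * (2 * I * l ^ 6 * q) := by
    obtain ⟨N, hN, hN5, -, hN3, hN1, -⟩ := exists_fifth_root hn'
    obtain ⟨e, he, he5, he2, -, -, -, he6⟩ := exists_fifth_root hε
    rw [hN3, hl2, he2] at hk2
    rw [hq, hN1, he6]
    calc 2 * (Λ / (k * ε)) ^ 2 ≤ 2 * (Λ / (N ^ 3 * l ^ 2 / e ^ 2 * ε)) ^ 2 := by gcongr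
      _ = _ := by
        rw [← hN5, ← he5, ← hl5]
        field_simp
  have hsq : 0 ≤ √r := Real.sqrt_nonneg r
  have hrn : 0 ≤ r ^ 3 * n := by positivity
  suffices hmain : v / k + m ^ 2 ≤ 1 / (n * I) * (1 + (2 + 4 * C * I) * √r
      + (8 * C ^ 2 * I + 16 * I * Λ ^ 2) * (r ^ 3 * n)) by
    refine (add_le_add hmain hnoise).trans ?_
    rw [← mul_add]
    refine mul_le_mul_of_nonneg_left ?_ (by positivity)
    have p1 : 0 ≤ (2 + 4 * C * I) * (r ^ 3 * n + q) := by positivity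
    have p2 : 0 ≤ (8 * C ^ 2 * I + 16 * I * Λ ^ 2) * (√r + q) := by positivity
    have p3 : 0 ≤ 2 * I * l ^ 6 * (√r + r ^ 3 * n) := by positivity
    linarith
  -- blocks of length at least two allow `1 / t ≤ 2 r`; otherwise `1 ≤ 8 r³` makes the claim trivial
  rcases le_or_gt r (1 / 2) with hc | hc
  · have h2k : 2 * k ≤ n := by
      rw [hr, div_le_iff₀ hn'] at hc
      have : (2 * k : ℝ) ≤ n := by linarith
      exact_mod_cast this
    set t := n / k with ht
    have ht1 : 1 ≤ t := (Nat.one_le_div_iff (by omega)).2 (by omega)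
    have ht' : (0 : ℝ) < t := by exact_mod_cast ht1
    have hkr : (k : ℝ) = r * n := by rw [hr]; field_simp
    have hlt : (n : ℝ) < k * (t + 1) := by exact_mod_cast Nat.lt_mul_div_succ n (by omega : 0 < k)
    have hkt : (n : ℝ) ≤ k * t * (1 + 2 * r) := by
      have : (n : ℝ) * (1 - r) ≤ k * t := by
        have : (k : ℝ) * (t + 1) = k * t + r * n := by rw [mul_add, ← hkr, mul_one]
        linarith
      have h2 : (n : ℝ) * (1 - r) * (1 + 2 * r) ≤ k * t * (1 + 2 * r) :=
        mul_le_mul_of_nonneg_right this (by linarith)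
      have h3 : 0 ≤ (n : ℝ) * (r * (1 - 2 * r)) :=
        mul_nonneg hn'.le (mul_nonneg hr0.le (by linarith))
      linarith
    have hkt1 : 1 / ((k : ℝ) * t) ≤ (1 + 2 * r) / n := by
      rw [div_le_div_iff₀ (by positivity) hn']; linarith
    have htr : 1 / (t : ℝ) ≤ 2 * r := by
      rw [div_le_iff₀ ht']
      have : (n : ℝ) ≤ 2 * (k * t) := by
        have : (1 : ℝ) ≤ t := by exact_mod_cast ht1
        have := mul_le_mul_of_nonneg_left this hk'.le
        linarith
      rw [hkr] at this
      have := le_of_mul_le_mul_right (by linarith : 1 * (n : ℝ) ≤ (2 * (r * t)) * n) hn'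
      linarith
    obtain ⟨-, hb, hV⟩ := hmom t ht1
    rw [← hm] at hb
    rw [← hv] at hV
    set h : ℝ := 1 / √t with hh
    have hpos : 0 < h := by positivity
    have hh2 : h ^ 2 = 1 / t := by rw [hh, div_pow, Real.sq_sqrt ht'.le, one_pow]
    have hhr : h ≤ 2 * √r := by
      refine abs_le_of_sq_le_sq' ?_ (by positivity) |>.2
      rw [hh2, mul_pow, Real.sq_sqrt hr0.le]
      linarith
    have hsr : r ≤ √r := by
      refine Real.le_sqrt_of_sq_le ?_
      rw [sq]; exact mul_le_of_le_one_left hr0.le (by linarith)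
    have hV' : v / k ≤ 1 / (n * I) * (1 + 2 * r) + C * (4 * √r / n) := by
      calc v / k ≤ (1 / (t * I) + C * h ^ 3) / k := div_le_div_of_nonneg_right hV hk'.le
        _ = 1 / I * (1 / (k * t)) + C * (h * (1 / (k * t))) := by
            rw [pow_succ h 2, hh2]; field_simp
        _ ≤ 1 / I * ((1 + 2 * r) / n) + C * (2 * √r * (2 / n)) := by
            have hkt2 : 1 / ((k : ℝ) * t) ≤ 2 / n :=
              hkt1.trans (div_le_div_of_nonneg_right (by linarith) hn'.le)
            exact add_le_add (mul_le_mul_of_nonneg_left hkt1 (by positivity))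
              (mul_le_mul_of_nonneg_left (mul_le_mul hhr hkt2 (by positivity) (by positivity)) hC)
        _ = _ := by field_simp; ring
    have hb' : m ^ 2 ≤ C ^ 2 * (8 * r ^ 3) := by
      calc m ^ 2 = |m| ^ 2 := (sq_abs m).symm
        _ ≤ (C * h ^ 3) ^ 2 := pow_le_pow_left₀ (abs_nonneg _) hb 2
        _ = C ^ 2 * (1 / t) ^ 3 := by rw [← hh2]; ring
        _ ≤ C ^ 2 * (2 * r) ^ 3 := by gcongr
        _ = _ := by ring
    have e : 1 / (n * I) * (1 + (2 + 4 * C * I) * √r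
        + (8 * C ^ 2 * I + 16 * I * Λ ^ 2) * (r ^ 3 * n))
        = 1 / (n * I) * (1 + 2 * √r) + C * (4 * √r / n) + C ^ 2 * (8 * r ^ 3)
          + 16 * Λ ^ 2 * r ^ 3 := by field_simp; ring
    have p1 : 1 / (n * I) * (1 + 2 * r) ≤ 1 / (n * I) * (1 + 2 * √r) := by gcongr
    have p2 : 0 ≤ 16 * Λ ^ 2 * r ^ 3 := by positivity
    rw [e]
    linarith
  · have bg : ∀ x, |bcMLE μ f a b mle (n / k) x - θ| ≤ Λ := fun x =>
      abs_sub_le_of_mem_Icc (bcMLE_mem hreg.lt.le mle _ x) hθ'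
    have bm : |m| ≤ Λ := by
      have := norm_integral_le_of_norm_le_const (μ := sampleLaw μ f (n / k) θ)
        (f := fun x => bcMLE μ f a b mle (n / k) x - θ) (C := Λ) (ae_of_all _ bg)
      simpa using this
    have bv : v ≤ Λ ^ 2 := by
      have := norm_integral_le_of_norm_le_const (μ := sampleLaw μ f (n / k) θ)
        (f := fun x => (bcMLE μ f a b mle (n / k) x - θ) ^ 2) (C := Λ ^ 2)
        (ae_of_all _ fun x => by
          rw [Real.norm_eq_abs, abs_of_nonneg (sq_nonneg _), ← sq_abs]
          exact pow_le_pow_left₀ (abs_nonneg _) (bg x) 2)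
      refine (le_abs_self v).trans ?_
      simpa using this
    have h1 : v / k ≤ Λ ^ 2 := (div_le_div_of_nonneg_right bv hk'.le).trans
      (div_le_self (sq_nonneg _) (by exact_mod_cast hk1))
    have h2 : m ^ 2 ≤ Λ ^ 2 := by rw [← sq_abs m]; exact pow_le_pow_left₀ (abs_nonneg _) bm 2
    have h3 : 1 ≤ 8 * r ^ 3 := by
      have := pow_le_pow_left₀ (by norm_num) hc.le 3
      linarith
    have h4 : Λ ^ 2 ≤ Λ ^ 2 * (8 * r ^ 3) := le_mul_of_one_le_right (sq_nonneg _) h3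
    have e : 1 / (n * I) * (1 + (2 + 4 * C * I) * √r
        + (8 * C ^ 2 * I + 16 * I * Λ ^ 2) * (r ^ 3 * n))
        = 1 / (n * I) * (1 + (2 + 4 * C * I) * √r + 8 * C ^ 2 * I * (r ^ 3 * n))
          + 2 * (Λ ^ 2 * (8 * r ^ 3)) := by field_simp; ring
    have p : 0 ≤ 1 / (n * I) * (1 + (2 + 4 * C * I) * √r + 8 * C ^ 2 * I * (r ^ 3 * n)) := by
      positivity
    rw [e]
    linarith

theorem exists_mse_le_of_le (hreg : RegularModel μ f a b) (hmle : IsMLE f a b mle) {θ : ℝ}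
    (hθ : θ ∈ Ioo a b) {ε₀ : ℝ} (hε₀ : 0 < ε₀) :
    ∃ C : ℝ, ∀ (n : ℕ) (ε : ℝ), 1 ≤ n → 0 < ε → ε ≤ ε₀ →
      mse μ f (sampleAggregate μ f a b mle ε (numBlocks (b - a) ε n) n) θ
        ≤ ENNReal.ofReal (1 / (n * fisherInfo μ f θ) *
          (1 + C * ((n : ℝ) ^ (-(1 / 5) : ℝ) * ε ^ (-(6 / 5) : ℝ)))) := by
  obtain ⟨C, hC, hmse⟩ := exists_mse_numBlocks_le hreg hmle hθ
  have hI := hreg.fisher_pos θ hθ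
  have hΛ : 0 < b - a := sub_pos.2 hreg.lt
  obtain ⟨l, hl, hl5, hl2, -⟩ := exists_fifth_root hΛ
  obtain ⟨z, hz, hz5, -⟩ := exists_fifth_root hε₀
  -- the unrounded number of blocks is at least `l² / z²`, so rounding costs a constant factor
  set c : ℝ := 1 + z ^ 2 / l ^ 2 with hc
  have hc0 : 0 < c := by positivity
  refine ⟨C * (√c * l * ε₀ + c ^ 3 * l ^ 6 + 1), fun n ε hn hε hεε => ?_⟩
  have hn' : (0 : ℝ) < n := by exact_mod_cast hn
  refine (hmse n ε hn hε _ rfl).trans (ENNReal.ofReal_le_ofReal ?_)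
  obtain ⟨-, -, hk3⟩ := numBlocks_bounds hΛ hε hn
  set k := numBlocks (b - a) ε n with hk
  obtain ⟨N, hN, hN5, -, hN3, hN1, -⟩ := exists_fifth_root hn'
  obtain ⟨e, he, he5, he2, -, -, -, he6⟩ := exists_fifth_root hε
  rw [hN3, hl2, he2] at hk3
  rw [hN1, he6, mul_assoc C]
  have hez : e ≤ z := by
    refine le_of_pow_le_pow_left₀ (n := 5) (by norm_num) hz.le ?_
    rw [he5, hz5]; exact hεε
  have hN1' : 1 ≤ N := by
    refine le_of_pow_le_pow_left₀ (n := 5) (by norm_num) hN.le ?_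
    rw [hN5, one_pow]; exact_mod_cast hn
  have hx : 1 ≤ N ^ 3 * l ^ 2 / e ^ 2 * (z ^ 2 / l ^ 2) := by
    have e1 : N ^ 3 * l ^ 2 / e ^ 2 * (z ^ 2 / l ^ 2) = N ^ 3 * (z / e) ^ 2 := by field_simp
    rw [e1]
    exact one_le_mul_of_one_le_of_one_le (one_le_pow₀ hN1')
      (one_le_pow₀ ((one_le_div he).2 hez))
  have hkr : (k : ℝ) / n ≤ c * (l / (N * e)) ^ 2 := by
    rw [div_le_iff₀ hn', ← hN5]
    calc (k : ℝ) ≤ N ^ 3 * l ^ 2 / e ^ 2 * c := by rw [hc, mul_add, mul_one]; linarith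
      _ = _ := by field_simp
  have h1 : √((k : ℝ) / n) ≤ √c * l * ε₀ * (1 / N * (1 / e ^ 6)) := by
    calc √((k : ℝ) / n) ≤ √(c * (l / (N * e)) ^ 2) := Real.sqrt_le_sqrt hkr
      _ = √c * (l / (N * e)) := by
          rw [Real.sqrt_mul hc0.le, Real.sqrt_sq (by positivity)]
      _ = √c * l * ε * (1 / N * (1 / e ^ 6)) := by rw [← he5]; field_simp
      _ ≤ _ := by gcongr
  have h2 : ((k : ℝ) / n) ^ 3 * n ≤ c ^ 3 * l ^ 6 * (1 / N * (1 / e ^ 6)) := by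
    calc ((k : ℝ) / n) ^ 3 * n ≤ (c * (l / (N * e)) ^ 2) ^ 3 * n := by gcongr
      _ = _ := by rw [← hN5]; field_simp
  refine mul_le_mul_of_nonneg_left ?_ (by positivity)
  gcongr
  linarith

theorem asymptoticallyEfficient_sampleAggregate (hreg : RegularModel μ f a b)
    (hmle : IsMLE f a b mle) {ε : ℕ → ℝ} (hε : ∀ n, 0 < ε n)
    (hlim : Tendsto (fun n : ℕ => ε n * (n : ℝ) ^ (1 / 6 : ℝ)) atTop atTop) :
    AsymptoticallyEfficient μ f a b (fun n =>
      sampleAggregate μ f a b mle (ε n) (numBlocks (b - a) (ε n) n) n) := by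
  intro θ hθ
  obtain ⟨C, hC, hmse⟩ := exists_mse_numBlocks_le hreg hmle hθ
  have hI := hreg.fisher_pos θ hθ
  have hΛ : 0 < b - a := sub_pos.2 hreg.lt
  obtain ⟨l, hl, hl5, hl2, -⟩ := exists_fifth_root hΛ
  have hlim' : Tendsto (fun n : ℕ => n * ε n) atTop atTop := by
    refine tendsto_atTop_mono' _ ?_ hlim
    filter_upwards [eventually_ge_atTop 1] with n hn
    rw [mul_comm]
    refine mul_le_mul_of_nonneg_right ?_ (hε n).le
    exact Real.rpow_le_self_of_one_le (by exact_mod_cast hn) (by norm_num)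
  -- `y n` is `k / n` before rounding; `ε n` may be unbounded, so the rounding error `1 / n` is kept
  set q : ℕ → ℝ := fun n => (ε n * (n : ℝ) ^ (1 / 6 : ℝ)) ^ (-(6 / 5) : ℝ) with hq
  set y : ℕ → ℝ := fun n => l ^ 2 * (n * ε n) ^ (-(2 / 5) : ℝ) with hy
  have tq : Tendsto q atTop (𝓝 0) := (tendsto_rpow_neg_atTop (by norm_num)).comp hlim
  have ty : Tendsto y atTop (𝓝 0) := by
    have := ((tendsto_rpow_neg_atTop (y := 2 / 5) (by norm_num)).comp hlim').const_mul (l ^ 2)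
    rwa [mul_zero] at this
  have tn : Tendsto (fun n : ℕ => 1 / (n : ℝ)) atTop (𝓝 0) := tendsto_one_div_atTop_nhds_zero_nat
  refine ⟨fun n => C * (√(y n + 1 / n) + 4 * (l ^ 6 * q n + (1 / (n : ℝ)) ^ 2) + q n), ?_, ?_⟩
  · have := (((ty.add tn).sqrt.add (((tq.const_mul (l ^ 6)).add (tn.pow 2)).const_mul 4)).add
      tq).const_mul C
    simpa using this
  filter_upwards [eventually_ge_atTop 1] with n hn
  have hn' : (0 : ℝ) < n := by exact_mod_cast hn
  refine (hmse n (ε n) hn (hε n) _ rfl).trans (ENNReal.ofReal_le_ofReal ?_)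
  obtain ⟨-, -, hk3⟩ := numBlocks_bounds hΛ (hε n) hn
  set k := numBlocks (b - a) (ε n) n with hk
  obtain ⟨N, hN, hN5, -, hN3, hN1, hN2, -⟩ := exists_fifth_root hn'
  obtain ⟨e, he, he5, he2, -, -, he2', he6⟩ := exists_fifth_root (hε n)
  have hqn : q n = 1 / N * (1 / e ^ 6) := by
    simp only [hq]
    rw [Real.mul_rpow (hε n).le (by positivity), ← Real.rpow_mul hn'.le, he6, ← hN1]
    norm_num [mul_comm]
  have hyn : y n = (l / (N * e)) ^ 2 := by
    simp only [hy]
    rw [Real.mul_rpow hn'.le (hε n).le, hN2, he2']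
    field_simp
  rw [hN3, hl2, he2] at hk3
  rw [hN1, he6, ← hqn, one_div_mul_eq_div]
  have hkr : (k : ℝ) / n ≤ y n + 1 / n := by
    rw [div_le_iff₀ hn', add_mul, div_mul_cancel₀ _ hn'.ne', hyn]
    refine hk3.trans (le_of_eq ?_)
    rw [← hN5]
    field_simp
  have hy0 : 0 ≤ y n := by rw [hyn]; positivity
  have h3 : ((k : ℝ) / n) ^ 3 * n ≤ 4 * (l ^ 6 * q n + (1 / (n : ℝ)) ^ 2) := by
    calc ((k : ℝ) / n) ^ 3 * n ≤ (y n + 1 / n) ^ 3 * n := by gcongr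
      _ ≤ 4 * (y n ^ 3 + (1 / (n : ℝ)) ^ 3) * n := by
          gcongr
          have := add_pow_le hy0 (by positivity : (0 : ℝ) ≤ 1 / n) 3
          norm_num at this ⊢
          linarith
      _ = _ := by
          rw [hyn, hqn, ← hN5]; field_simp
  gcongr

end Rates

/-! ### Existence of private and asymptotically efficient estimators -/

theorem exists_private_efficient {D : Type*} [MeasurableSpace D] {μ : Measure D}
    {f : D → ℝ → ℝ} {a b : ℝ} (hreg : RegularModel μ f a b) :
    ∃ (ε : ℕ → ℝ) (T : ∀ n : ℕ, (Fin n → D) → Measure ℝ),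
      (∀ n, 0 < ε n) ∧ Tendsto ε atTop (𝓝 0) ∧
      (∀ n, IsRandomizedEstimator (T n) ∧
        IsDifferentiallyPrivate (ε n) (T n)) ∧
      AsymptoticallyEfficient μ f a b T := by
  obtain ⟨mle, hmle⟩ := exists_isMLE hreg
  -- any rate between `n^{-1/6}` and `1` would do
  set ε : ℕ → ℝ := fun n => ((max 1 n : ℕ) : ℝ) ^ (-(1 / 12) : ℝ) with hε
  have hpos : ∀ n, 0 < ε n := fun n => by
    have : (0 : ℝ) < (max 1 n : ℕ) := by exact_mod_cast lt_max_of_lt_left one_pos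
    positivity
  have he : ∀ n : ℕ, 1 ≤ n → ε n = (n : ℝ) ^ (-(1 / 12) : ℝ) := fun n hn => by
    simp only [hε]; rw [max_eq_right hn]
  -- the recommended number of blocks vanishes for the empty sample
  refine ⟨ε, fun n => sampleAggregate μ f a b mle (ε n)
    (max 1 (numBlocks (b - a) (ε n) n)) n, hpos, ?_, fun n => ⟨?_, ?_⟩, ?_⟩
  · have h : Tendsto (fun n : ℕ => (n : ℝ) ^ (-(1 / 12) : ℝ)) atTop (𝓝 0) :=
      (tendsto_rpow_neg_atTop (by norm_num)).comp tendsto_natCast_atTop_atTop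
    refine h.congr' ?_
    filter_upwards [eventually_ge_atTop 1] with n hn using (he n hn).symm
  · exact isRandomizedEstimator_sampleAggregate hreg hmle (hpos n) (le_max_left _ _) n
  · exact isDifferentiallyPrivate_sampleAggregate hreg (hpos n) (le_max_left _ _) n
  · have hlim : Tendsto (fun n : ℕ => ε n * (n : ℝ) ^ (1 / 6 : ℝ)) atTop atTop := by
      have h : Tendsto (fun n : ℕ => (n : ℝ) ^ (1 / 12 : ℝ)) atTop atTop :=
        (tendsto_rpow_atTop (by norm_num)).comp tendsto_natCast_atTop_atTop
      refine h.congr' ?_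
      filter_upwards [eventually_ge_atTop 1] with n hn
      have hn' : (0 : ℝ) < n := by exact_mod_cast hn
      rw [he n hn, ← Real.rpow_add hn']
      norm_num
    intro θ hθ
    obtain ⟨δ, hδ, h⟩ :=
      asymptoticallyEfficient_sampleAggregate hreg hmle hpos hlim θ hθ
    refine ⟨δ, hδ, ?_⟩
    filter_upwards [h, eventually_ge_atTop 1] with n h hn
    rwa [max_eq_right (numBlocks_bounds (sub_pos.2 hreg.lt) (hpos n) hn).1]

end PrivEst

end

theorem mainTheorem1 {D : Type*} [MeasurableSpace D] (μ : Measure D) [SigmaFinite μ]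
    (f : D → ℝ → ℝ) (a b : ℝ) (hreg : PrivEst.RegularModel μ f a b) :
    -- existence of a private, asymptotically efficient estimator
    (∃ (ε : ℕ → ℝ) (T : ∀ n : ℕ, (Fin n → D) → Measure ℝ),
      (∀ n, 0 < ε n) ∧ Tendsto ε atTop (𝓝 0) ∧
      (∀ n, PrivEst.IsRandomizedEstimator (T n) ∧
        PrivEst.IsDifferentiallyPrivate (ε n) (T n)) ∧
      PrivEst.AsymptoticallyEfficient μ f a b T) ∧
    -- the maximum likelihood estimator exists
    (∃ mle : ∀ n : ℕ, (Fin n → D) → ℝ, PrivEst.IsMLE f a b mle) ∧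
    ∀ mle : ∀ n : ℕ, (Fin n → D) → ℝ, PrivEst.IsMLE f a b mle →
      -- `b₁` is the first-order bias coefficient of the MLE
      (∀ θ ∈ Ioo a b, ∃ C : ℝ, ∀ n : ℕ, 1 ≤ n →
        |(∫ x, (mle n x - θ) ∂(PrivEst.sampleLaw μ f n θ)) - PrivEst.biasCoeff μ f θ / n|
          ≤ C * (n : ℝ) ^ (-(3 / 2) : ℝ)) ∧
      -- privacy of the sample-and-aggregate estimator, for every number of blocks
      (∀ (n k : ℕ) (ε : ℝ), 1 ≤ k → 0 < ε →
        PrivEst.IsRandomizedEstimator (PrivEst.sampleAggregate μ f a b mle ε k n) ∧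
        PrivEst.IsDifferentiallyPrivate ε (PrivEst.sampleAggregate μ f a b mle ε k n)) ∧
      -- its mean squared error
      (∀ θ ∈ Ioo a b, ∀ ε₀ : ℝ, 0 < ε₀ → ∃ C : ℝ, ∀ (n : ℕ) (ε : ℝ), 1 ≤ n → 0 < ε → ε ≤ ε₀ →
        PrivEst.mse μ f
            (PrivEst.sampleAggregate μ f a b mle ε (PrivEst.numBlocks (b - a) ε n) n) θ
          ≤ ENNReal.ofReal (1 / (n * PrivEst.fisherInfo μ f θ) *
              (1 + C * ((n : ℝ) ^ (-(1 / 5) : ℝ) * ε ^ (-(6 / 5) : ℝ))))) ∧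
      -- its efficiency whenever `ε n^{1/6} → ∞`
      (∀ ε : ℕ → ℝ, (∀ n, 0 < ε n) →
        Tendsto (fun n : ℕ => ε n * (n : ℝ) ^ (1 / 6 : ℝ)) atTop atTop →
        PrivEst.AsymptoticallyEfficient μ f a b (fun n =>
          PrivEst.sampleAggregate μ f a b mle (ε n)
            (PrivEst.numBlocks (b - a) (ε n) n) n)) := by
  refine ⟨PrivEst.exists_private_efficient hreg, PrivEst.exists_isMLE hreg, fun mle hmle =>
    ⟨fun θ hθ => ?_, fun n k ε hk hε =>
      ⟨PrivEst.isRandomizedEstimator_sampleAggregate hreg hmle hε hk n,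
        PrivEst.isDifferentiallyPrivate_sampleAggregate hreg hε hk n⟩,
      fun θ hθ ε₀ hε₀ => PrivEst.exists_mse_le_of_le hreg hmle hθ hε₀,
      fun ε hε hlim => PrivEst.asymptoticallyEfficient_sampleAggregate hreg hmle hε hlim⟩⟩
  obtain ⟨C, -, hC⟩ := hmle.exists_moment_expansions hreg hθ
  refine ⟨C, fun n hn => (hC n hn).1.trans (le_of_eq ?_)⟩
  have hn' : (0 : ℝ) ≤ n := Nat.cast_nonneg n
  rw [Real.sqrt_eq_rpow, one_div, ← Real.rpow_neg hn', ← Real.rpow_natCast, ← Real.rpow_mul hn']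
  norm_num
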